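/- Throughout, a kernel on a second countable topological space $\mathcal R$ (for instance $\mathcal R\subseteq\mathbb R^d$), equipped with its Borel $\sigma$-algebra, is a continuous positive definite (i.e. symmetric and positive semidefinite) function $k:\mathcal R\times\mathcal R\to\mathbb R$ with $k(x,x)=1$ for all $x$. Let $\mathcal H$ be its (real) reproducing kernel Hilbert space and $\phi(x)=k(\cdot,x)\in\mathcal H$. The covariance operator of a probability measure $p$ on $\mathcal R$ is $\Sigma_p=\int \phi(x)\phi(x)^*\,dp(x)$, a positive trace-class operator on $\mathcal H$. For $\alpha\in(0,1)\cup(1,\infty)$, $\lambda\ge 0$, and positive bounded operators $A,B$ with $A$ nonzero and of finite trace, the regularized quantum Rényi divergence is $$D_{\alpha,\lambda}(A\|B)=\frac1{\alpha-1}\log\left(\frac1{\mathrm{tr}[A]}\,\mathrm{tr}\left[\left((B+\lambda \mathrm{Id})^{\frac{1-\alpha}{2\alpha}}A(B+\lambda \mathrm{Id})^{\frac{1-\alpha}{2\alpha}}\right)^{\alpha}\right]\right)\in[-\infty,+\infty],$$ where traces of positive operators take values in $[0,\infty]$, $\log 0=-\infty$, $\log\infty=\infty$. For $\alpha>1$ and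 $C=B+\lambda\mathrm{Id}$ not necessarily invertible, $C^{\frac{1-\alpha}{2\alpha}}AC^{\frac{1-\alpha}{2\alpha}}$ denotes the unique positive bounded operator $\tau$ vanishing on $\ker C$ with $C^{\frac{\alpha-1}{2\alpha}}\tau C^{\frac{\alpha-1}{2\alpha}}=A$, and $D_{\alpha,\lambda}(A\|B)=+\infty$ if no such $\tau$ exists. Let $\mathcal D$ be a set with a relation "adjacent". A randomized mechanism $f:\mathcal D\to\mathcal R$ assigns to each $D\in\mathcal D$ an $\mathcal R$-valued random variable $f(D)$, with law $\mathcal L(f(D))$. It is $(k,\alpha,\lambda,\varepsilon)$-RKRDP (regularized kernel Rényi differentially private) if $D_{\alpha,\lambda}\big(\Sigma_{\mathcal L(f(D))}\big\|\Sigma_{\mathcal L(f(D'))}\big)\le\varepsilon$ for all adjacent $D,D'\in\mathcal D$, the covariance operators being those of $k$. **Proposition (parallel composition).** Let $\alpha\in(0,1)\cup(1,\infty)$, $\lambda\ge0$ and $\varepsilon_1,\varepsilon_2\in\mathbb R$, and assume that $\lambda\le 3$ or $\varepsilon_1+\varepsilon_2\ge 0$. Let $k_1,k_2$ be kernels on $\mathcal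 R_1,\mathcal R_2$. Let $f:\mathcal D\to\mathcal R_1$ and $g:\mathcal D\to\mathcal R_2$ be randomized mechanisms defined on a common probability space such that $f(D)$ and $g(D)$ are independent for every $D\in\mathcal D$. If $f$ is $(k_1,\alpha,\lambda/3,\varepsilon_1)$-RKRDP and $g$ is $(k_2,\alpha,\lambda/3,\varepsilon_2)$-RKRDP, then the mechanism $(f,g):\mathcal D\to\mathcal R_1\times\mathcal R_2$, $D\mapsto(f(D),g(D))$, is $(k,\alpha,\lambda,\varepsilon_1+\varepsilon_2)$-RKRDP, where $k$ is the product kernel $k((x,y),(x',y'))=k_1(x,x')\,k_2(y,y')$. -/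

import Mathlib

/-! ### Continuous functional calculus for self-adjoint operators on a real Hilbert space

Mathlib provides it for complex Hilbert spaces only. -/

namespace RealCFC

section

open Polynomial

variable {H : Type*} [NormedAddCommGroup H] [InnerProductSpace ℝ H] [CompleteSpace H]

theorem isUnit_sq_add {b : H →L[ℝ] H} (hb : IsSelfAdjoint b) {d : ℝ} (hd : 0 < d) :
    IsUnit (b * b + algebraMap ℝ (H →L[ℝ] H) d) := by
  refine ContinuousLinearMap.isUnit_of_forall_le_norm_inner_map _ (c := ⟨d, hd.le⟩) hd fun x => ?_
  have h1 : inner ℝ (b (b x)) x = ‖b x‖ ^ 2 := by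
    rw [hb.isSymmetric.apply_clm (b x) x, real_inner_self_eq_norm_sq]
  have h2 : inner ℝ ((b * b + algebraMap ℝ (H →L[ℝ] H) d) x) x = ‖b x‖ ^ 2 + d * ‖x‖ ^ 2 := by
    simp [Algebra.algebraMap_eq_smul_one, inner_add_left, h1, inner_smul_left]
  rw [h2]
  refine le_trans ?_ (le_abs_self _)
  change ‖x‖ ^ 2 * d ≤ _
  nlinarith [sq_nonneg ‖b x‖]

theorem isSelfAdjoint_aeval {a : H →L[ℝ] H} (ha : IsSelfAdjoint a) (p : ℝ[X]) :
    IsSelfAdjoint (aeval a p) := by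
  induction p using Polynomial.induction_on' with
  | add p q hp hq => rw [map_add]; exact hp.add hq
  | monomial n r =>
    rw [aeval_monomial, ← Algebra.smul_def, IsSelfAdjoint, star_smul, star_trivial,
      (ha.pow n).star_eq]

theorem isUnit_quadratic {a : H →L[ℝ] H} (ha : IsSelfAdjoint a) {u v w : ℝ}
    (h : 0 < 4 * u * w - v ^ 2) : IsUnit (aeval a (C u * X ^ 2 + C v * X + C w)) := by
  have hu : u ≠ 0 := by
    rintro rfl
    nlinarith [sq_nonneg v]
  have hb : IsSelfAdjoint (aeval a (C (2 * u) * X + C v)) := isSelfAdjoint_aeval ha _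
  have key := isUnit_sq_add hb h
  have hpoly : (C (2 * u) * X + C v) * (C (2 * u) * X + C v) + C (4 * u * w - v ^ 2) =
      C (4 * u) * (C u * X ^ 2 + C v * X + C w) := by
    have e2 : (C 2 : ℝ[X]) = 2 := rfl
    have e4 : (C 4 : ℝ[X]) = 4 := rfl
    simp only [C_mul, C_sub, C_pow, e2, e4]
    ring
  have h2 := congrArg (aeval a) hpoly
  rw [map_add, map_mul, aeval_C, map_mul (aeval a) (C (4 * u)), aeval_C] at h2
  rw [h2] at key
  have h4 : IsUnit (algebraMap ℝ (H →L[ℝ] H) (4 * u)) := (IsUnit.mk0 _ (by positivity)).map _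
  obtain ⟨z, hz⟩ := h4
  rw [← hz] at key
  exact (Units.isUnit_units_mul z _).1 key

theorem isUnit_aeval {a : H →L[ℝ] H} (ha : IsSelfAdjoint a) (p : ℝ[X])
    (hp : p ≠ 0) (h : ∀ t ∈ spectrum ℝ a, p.eval t ≠ 0) : IsUnit (aeval a p) := by
  induction p using WfDvdMonoid.induction_on_irreducible with
  | zero => exact absurd rfl hp
  | unit u hu => exact hu.map (aeval a)
  | mul q i hq hi ih =>
    rw [map_mul]
    refine IsUnit.mul ?_ (ih hq fun t ht h0 => h t ht (by simp [h0]))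
    have hi' : ∀ t ∈ spectrum ℝ a, i.eval t ≠ 0 := fun t ht h0 => h t ht (by simp [h0])
    by_cases hr : ∃ r, i.IsRoot r
    · obtain ⟨r, hr⟩ := hr
      have hd : X - C r ∣ i := dvd_iff_isRoot.2 hr
      obtain ⟨u, hu⟩ := (irreducible_X_sub_C r).associated_of_dvd hi hd
      rw [← hu, map_mul]
      refine IsUnit.mul ?_ (u.isUnit.map (aeval a))
      have hs : r ∉ spectrum ℝ a := fun hs => hi' r hs hr
      rw [spectrum.notMem_iff, IsUnit.sub_iff] at hs
      simpa using hs
    · push Not at hr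
      have hc := eq_quadratic_of_degree_le_two (natDegree_le_iff_degree_le.1 hi.natDegree_le_two)
      generalize i.coeff 2 = u at hc
      generalize i.coeff 1 = v at hc
      generalize i.coeff 0 = w at hc
      have hu : u ≠ 0 := by
        rintro rfl
        by_cases hv : v = 0
        · subst hv
          have hw : w ≠ 0 := by
            rintro rfl
            exact hi.ne_zero (by simpa using hc)
          refine hi.not_isUnit ?_
          rw [hc]
          simpa using hw
        · refine hr (-w / v) ?_
          rw [hc]
          simp [IsRoot]
          field_simp
          ring
      have hdisc : 0 < 4 * u * w - v ^ 2 := by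
        by_contra hd
        push Not at hd
        have hs := Real.sq_sqrt (show 0 ≤ v ^ 2 - 4 * u * w by linarith)
        generalize √(v ^ 2 - 4 * u * w) = z at hs
        refine hr ((-v + z) / (2 * u)) ?_
        rw [hc]
        simp only [IsRoot, eval_add, eval_mul, eval_C, eval_pow, eval_X]
        field_simp
        linear_combination hs
      rw [hc]
      exact isUnit_quadratic ha hdisc

theorem sq_norm_mem_spectrum [Nontrivial H] {b : H →L[ℝ] H} (hb : IsSelfAdjoint b) :
    ‖b‖ ^ 2 ∈ spectrum ℝ (b * b) := by
  rw [spectrum.mem_iff]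
  intro hu
  set c := algebraMap ℝ (H →L[ℝ] H) (‖b‖ ^ 2) - b * b with hc
  have hcx (x y : H) : inner ℝ (c x) y = ‖b‖ ^ 2 * inner ℝ x y - inner ℝ (b x) (b y) := by
    have : inner ℝ (b (b x)) y = inner ℝ (b x) (b y) := hb.isSymmetric.apply_clm (b x) y
    simp [hc, Algebra.algebraMap_eq_smul_one, inner_sub_left, inner_smul_left, this]
  have hnn (x : H) : 0 ≤ inner ℝ (c x) x := by
    rw [hcx, real_inner_self_eq_norm_sq, real_inner_self_eq_norm_sq, ← mul_pow, sub_nonneg]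
    exact pow_le_pow_left₀ (norm_nonneg _) (b.le_opNorm x) 2
  -- Cauchy-Schwarz for the positive form of `c`
  have hcs (x : H) : ‖c x‖ ^ 2 ≤ ‖c‖ * inner ℝ (c x) x := by
    have hsym : inner ℝ (c (c x)) x = ‖c x‖ ^ 2 := by
      rw [hcx, ← real_inner_self_eq_norm_sq (c x), real_inner_comm (c x) (c x), hcx x (c x),
        real_inner_comm x, real_inner_comm (b x)]
    have hq (t : ℝ) : 0 ≤ inner ℝ (c x) x - 2 * t * ‖c x‖ ^ 2 + t ^ 2 * (‖c‖ * ‖c x‖ ^ 2) := by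
      have h1 := hnn (x - t • c x)
      have h2 : inner ℝ (c (c x)) (c x) ≤ ‖c‖ * ‖c x‖ ^ 2 := by
        refine (real_inner_le_norm _ _).trans ?_
        nlinarith [c.le_opNorm (c x), norm_nonneg (c x)]
      simp only [map_sub, map_smul, inner_sub_left, inner_sub_right, inner_smul_left,
        inner_smul_right, hsym, real_inner_self_eq_norm_sq, RCLike.conj_to_real] at h1
      nlinarith [mul_le_mul_of_nonneg_left h2 (sq_nonneg t)]
    rcases eq_or_lt_of_le (norm_nonneg c) with h0 | h0
    · have : c = 0 := norm_eq_zero.1 h0.symm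
      simp [this]
    · have := hq (1 / ‖c‖)
      field_simp at this
      nlinarith
  obtain ⟨d, hd⟩ := hu.exists_left_inv
  have hle (x : H) : ‖x‖ ≤ ‖d‖ * ‖c x‖ := by
    have : d (c x) = x := by
      change (d * c) x = x
      rw [hd]; rfl
    calc ‖x‖ = ‖d (c x)‖ := by rw [this]
      _ ≤ _ := d.le_opNorm _
  set K := ‖d‖ ^ 2 * ‖c‖ with hK
  have hK0 : 0 ≤ K := by positivity
  have hx (x : H) : ‖x‖ ^ 2 ≤ K * (‖b‖ ^ 2 * ‖x‖ ^ 2 - ‖b x‖ ^ 2) := by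
    have h1 := hcs x
    rw [hcx, real_inner_self_eq_norm_sq, real_inner_self_eq_norm_sq] at h1
    calc ‖x‖ ^ 2 ≤ (‖d‖ * ‖c x‖) ^ 2 := pow_le_pow_left₀ (norm_nonneg _) (hle x) 2
      _ = ‖d‖ ^ 2 * ‖c x‖ ^ 2 := by ring
      _ ≤ ‖d‖ ^ 2 * (‖c‖ * (‖b‖ ^ 2 * ‖x‖ ^ 2 - ‖b x‖ ^ 2)) := by gcongr
      _ = _ := by rw [hK]; ring
  have hKpos : 0 < K := by
    obtain ⟨x, hx0⟩ := exists_ne (0 : H)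
    rcases eq_or_lt_of_le hK0 with h | h
    · have := hx x
      rw [← h] at this
      have : 0 < ‖x‖ ^ 2 := by positivity
      linarith
    · exact h
  have hb2 (x : H) : ‖b x‖ ^ 2 ≤ (‖b‖ ^ 2 - 1 / K) * ‖x‖ ^ 2 := by
    have := hx x
    have h3 : ‖x‖ ^ 2 / K ≤ ‖b‖ ^ 2 * ‖x‖ ^ 2 - ‖b x‖ ^ 2 := by
      rw [div_le_iff₀ hKpos]; linarith
    have : (1 / K) * ‖x‖ ^ 2 = ‖x‖ ^ 2 / K := by ring
    nlinarith
  have hs : 0 ≤ ‖b‖ ^ 2 - 1 / K := by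
    obtain ⟨x, hx0⟩ := exists_ne (0 : H)
    have h0 : 0 < ‖x‖ ^ 2 := by positivity
    by_contra hneg
    push Not at hneg
    nlinarith [hb2 x, sq_nonneg ‖b x‖]
  have hnorm : ‖b‖ ≤ √(‖b‖ ^ 2 - 1 / K) := by
    refine b.opNorm_le_bound (Real.sqrt_nonneg _) fun x => ?_
    rw [← Real.sqrt_sq (norm_nonneg x), ← Real.sqrt_mul hs]
    exact Real.le_sqrt_of_sq_le (hb2 x)
  have := Real.sq_sqrt hs
  have h5 := pow_le_pow_left₀ (norm_nonneg b) hnorm 2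
  rw [this] at h5
  have : 0 < 1 / K := by positivity
  linarith

theorem spectrum_nonempty [Nontrivial H] {a : H →L[ℝ] H} (ha : IsSelfAdjoint a) :
    (spectrum ℝ a).Nonempty := by
  by_contra hs
  rw [Set.not_nonempty_iff_eq_empty] at hs
  have h := sq_norm_mem_spectrum ha
  rw [spectrum.mem_iff] at h
  apply h
  have hp : (C (‖a‖ ^ 2) - X ^ 2 : ℝ[X]) ≠ 0 := by
    intro h0
    have := congrArg (fun p => p.coeff 2) h0
    rw [coeff_sub, coeff_C] at this
    simp [coeff_X_pow] at this
  simpa [pow_two] using isUnit_aeval ha _ hp (by simp [hs])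

theorem spectrum_aeval [Nontrivial H] {a : H →L[ℝ] H} (ha : IsSelfAdjoint a) (p : ℝ[X]) :
    spectrum ℝ (aeval a p) = (fun t => p.eval t) '' spectrum ℝ a := by
  refine Set.Subset.antisymm (fun μ hμ => ?_) (spectrum.subset_polynomial_aeval a p)
  by_contra hn
  rw [spectrum.mem_iff] at hμ
  apply hμ
  have hne : ∀ t ∈ spectrum ℝ a, (C μ - p).eval t ≠ 0 := fun t ht h0 =>
    hn ⟨t, ht, by simp at h0 ⊢; linarith⟩
  have h0 : C μ - p ≠ 0 := by
    intro h0
    obtain ⟨t, ht⟩ := spectrum_nonempty ha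
    exact hne t ht (by rw [h0]; simp)
  simpa using isUnit_aeval ha _ h0 hne

theorem norm_aeval [Nontrivial H] {a : H →L[ℝ] H} (ha : IsSelfAdjoint a) (p : ℝ[X]) :
    ‖aeval a p‖ = ‖p.toContinuousMapOn (spectrum ℝ a)‖ := by
  have hsa := isSelfAdjoint_aeval ha p
  apply le_antisymm
  · have h := sq_norm_mem_spectrum hsa
    rw [← map_mul, spectrum_aeval ha] at h
    obtain ⟨t, ht, h⟩ := h
    have h1 := (p.toContinuousMapOn (spectrum ℝ a)).norm_coe_le_norm ⟨t, ht⟩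
    simp only [toContinuousMapOn_apply, toContinuousMap_apply] at h1
    have h2 : ‖aeval a p‖ = ‖p.eval t‖ := by
      rw [← sq_eq_sq₀ (norm_nonneg _) (norm_nonneg _), ← h]
      simp [pow_two]
    rw [h2]; exact h1
  · rw [ContinuousMap.norm_le _ (norm_nonneg _)]
    rintro ⟨t, ht⟩
    refine spectrum.norm_le_norm_of_mem (𝕜 := ℝ) (a := aeval a p) ?_
    rw [spectrum_aeval ha]
    exact ⟨t, ht, rfl⟩

theorem exists_cfcHom [Nontrivial H] {a : H →L[ℝ] H} (ha : IsSelfAdjoint a) :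
    ∃ φ : C(spectrum ℝ a, ℝ) →⋆ₐ[ℝ] (H →L[ℝ] H), Continuous φ ∧ Function.Injective φ ∧
      φ ((ContinuousMap.id ℝ).restrict <| spectrum ℝ a) = a ∧
      (∀ f, spectrum ℝ (φ f) = Set.range f) ∧ ∀ f, IsSelfAdjoint (φ f) := by
  let e : ℝ[X] →ₗ[ℝ] C(spectrum ℝ a, ℝ) := (toContinuousMapOnAlgHom (spectrum ℝ a)).toLinearMap
  let g : ℝ[X] →ₗ[ℝ] (H →L[ℝ] H) := (aeval a).toLinearMap
  have he (p : ℝ[X]) : e p = p.toContinuousMapOn (spectrum ℝ a) := rfl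
  have hdense : DenseRange e := by
    intro f
    have h := polynomialFunctions.topologicalClosure (spectrum ℝ a)
    have hf : f ∈ (polynomialFunctions (spectrum ℝ a)).topologicalClosure := h ▸ Algebra.mem_top
    rw [← SetLike.mem_coe, Subalgebra.topologicalClosure_coe, polynomialFunctions_coe] at hf
    exact hf
  have hbd (p : ℝ[X]) : ‖g p‖ ≤ 1 * ‖e p‖ := by
    rw [one_mul, he]
    exact (norm_aeval ha p).le
  let φ : C(spectrum ℝ a, ℝ) →L[ℝ] (H →L[ℝ] H) :=
    LinearMap.extendOfNorm (E := ℝ[X]) (Eₗ := C(spectrum ℝ a, ℝ)) (F := H →L[ℝ] H) g e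
  have hφ (p : ℝ[X]) : φ (e p) = aeval a p := LinearMap.extendOfNorm_eq hdense ⟨1, hbd⟩ p
  have hcn : Continuous fun f : C(spectrum ℝ a, ℝ) => ‖f‖ :=
    continuous_norm (E := C(spectrum ℝ a, ℝ))
  have hnorm (f : C(spectrum ℝ a, ℝ)) : ‖φ f‖ = ‖f‖ := by
    refine hdense.induction_on f
      (isClosed_eq (continuous_norm.comp φ.continuous) hcn) fun p => ?_
    rw [hφ, he, norm_aeval ha]
  have hone : φ 1 = 1 := by
    have : (1 : C(spectrum ℝ a, ℝ)) = e 1 := (map_one (toContinuousMapOnAlgHom (spectrum ℝ a))).symm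
    rw [this, hφ, map_one]
  have hmul (f f' : C(spectrum ℝ a, ℝ)) : φ (f * f') = φ f * φ f' := by
    refine hdense.induction_on₂ (p := fun f f' => φ (f * f') = φ f * φ f')
      (isClosed_eq (by fun_prop) (by fun_prop)) (fun p q => ?_) f f'
    have : e p * e q = e (p * q) := (map_mul (toContinuousMapOnAlgHom (spectrum ℝ a)) p q).symm
    rw [this, hφ, hφ, hφ, map_mul]
  have hsa (f) : IsSelfAdjoint (φ f) := by
    refine hdense.induction_on f (isClosed_eq (by fun_prop) (by fun_prop)) fun p => ?_
    rw [hφ]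
    exact isSelfAdjoint_aeval ha p
  let A : C(spectrum ℝ a, ℝ) →ₐ[ℝ] (H →L[ℝ] H) := AlgHom.ofLinearMap φ.toLinearMap hone hmul
  have hA (f) : A f = φ f := rfl
  let Φ : C(spectrum ℝ a, ℝ) →⋆ₐ[ℝ] (H →L[ℝ] H) :=
    { A with
      map_star' := fun f => by
        change φ (star f) = star (φ f)
        rw [(hsa f).star_eq, star_trivial] }
  have hΦ (f) : Φ f = φ f := rfl
  refine ⟨Φ, φ.continuous, ?_, ?_, fun f => ?_, hsa⟩
  · intro f f' h
    have h1 : ‖f - f'‖ = 0 := by rw [← hnorm, map_sub, ← hΦ, ← hΦ, h, sub_self, norm_zero]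
    exact sub_eq_zero.1 (norm_eq_zero.1 h1)
  · rw [hΦ, ← toContinuousMapOn_X_eq_restrict_id, ← he, hφ, aeval_X]
  · refine Set.Subset.antisymm ?_ ?_
    · have h := AlgHom.spectrum_apply_subset A f
      rwa [ContinuousMap.spectrum_eq_range] at h
    · rintro _ ⟨t, rfl⟩
      -- the spectrum is closed under limits of polynomials
      by_contra hn
      rw [spectrum.notMem_iff, hΦ] at hn
      have hcont : Continuous fun f' : C(spectrum ℝ a, ℝ) =>
          algebraMap ℝ (H →L[ℝ] H) (f' t) - φ f' := by fun_prop
      have hopen := (Units.isOpen (R := H →L[ℝ] H)).preimage hcont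
      obtain ⟨p, hp⟩ := hdense.exists_mem_open hopen ⟨f, hn⟩
      have ht : p.eval t.1 ∈ spectrum ℝ (aeval a p) :=
        spectrum.subset_polynomial_aeval a p ⟨t.1, t.2, rfl⟩
      rw [spectrum.mem_iff] at ht
      apply ht
      rw [← hφ]
      exact hp

instance instContinuousFunctionalCalculus :
    ContinuousFunctionalCalculus ℝ (H →L[ℝ] H) IsSelfAdjoint where
  predicate_zero := .zero _
  spectrum_nonempty a ha := by
    have : Nontrivial H := by
      by_contra hH
      rw [not_nontrivial_iff_subsingleton] at hH
      exact not_subsingleton (H →L[ℝ] H) inferInstance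
    exact spectrum_nonempty ha
  exists_cfc_of_predicate a ha := by
    cases subsingleton_or_nontrivial H with
    | inr h => exact exists_cfcHom ha
    | inl h =>
      have hs (b : H →L[ℝ] H) : spectrum ℝ b = ∅ := spectrum.of_subsingleton b
      have : IsEmpty (spectrum ℝ a) := by rw [hs]; infer_instance
      let A : C(spectrum ℝ a, ℝ) →⋆ₐ[ℝ] (H →L[ℝ] H) :=
        { toFun := fun _ => 0
          map_one' := Subsingleton.elim _ _
          map_mul' := fun _ _ => Subsingleton.elim _ _
          map_zero' := rfl
          map_add' := fun _ _ => Subsingleton.elim _ _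
          commutes' := fun _ => Subsingleton.elim _ _
          map_star' := fun _ => Subsingleton.elim _ _ }
      refine ⟨A, continuous_const, fun f f' _ => ?_, Subsingleton.elim _ _, fun f => ?_,
        fun f => Subsingleton.elim _ _⟩
      · ext t
        exact isEmptyElim t
      · rw [hs, Set.range_eq_empty]

end

end RealCFC

/-! ### Kernels and their reproducing kernel Hilbert spaces -/

/-- A continuous positive definite kernel `k : X × X → ℝ` normalised by `k x x = 1`.
(`Matrix.PosSemidef` for a possibly infinite index type: symmetry and
`0 ≤ ∑ i, ∑ j, c i * k (x i) (x j) * c j` for all finitely supported `c`.) -/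
structure PDKernel (X : Type*) [TopologicalSpace X] where
  /-- The kernel function. -/
  toFun : X → X → ℝ
  continuous_toFun : Continuous fun p : X × X => toFun p.1 p.2
  posSemidef : (Matrix.of toFun).PosSemidef
  diag_eq_one : ∀ x, toFun x x = 1

namespace PDKernel

section RKHS

variable {X : Type*} [TopologicalSpace X] (k : PDKernel X)

/-- The kernel as an operator-valued kernel, acting on `ℝ` by scalar multiplication. -/
def opKernel : Matrix X X (ℝ →L[ℝ] ℝ) :=
  Matrix.of fun x y => k.toFun x y • ContinuousLinearMap.id ℝ ℝ

instance factPosSemidef : Fact k.opKernel.PosSemidef := by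
  have key := (RKHS.posSemidef_tfae (K := k.opKernel)).out 0 2
  refine ⟨key.2 ⟨?_, fun c => ?_⟩⟩
  · ext x y
    have h := k.posSemidef.1.apply x y
    simp only [Matrix.of_apply, star_trivial] at h
    have h1 : star (ContinuousLinearMap.id ℝ ℝ) = ContinuousLinearMap.id ℝ ℝ :=
      star_one (ℝ →L[ℝ] ℝ)
    simp [opKernel, h, h1]
  · have h := k.posSemidef.2 c
    rw [Finsupp.sum_comm] at h
    refine h.trans_eq ?_
    simp [opKernel, mul_comm, mul_left_comm]

/-- The reproducing kernel Hilbert space of functions `X → ℝ` with kernel `k`. -/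
def rkhs : Type _ := RKHS.OfKernel k.opKernel

noncomputable instance instNormedAddCommGroupRkhs : NormedAddCommGroup k.rkhs :=
  inferInstanceAs (NormedAddCommGroup (RKHS.OfKernel k.opKernel))

noncomputable instance instInnerProductSpaceRkhs : InnerProductSpace ℝ k.rkhs :=
  inferInstanceAs (InnerProductSpace ℝ (RKHS.OfKernel k.opKernel))

instance instCompleteSpaceRkhs : CompleteSpace k.rkhs :=
  inferInstanceAs (CompleteSpace (RKHS.OfKernel k.opKernel))

noncomputable instance instRKHS : RKHS ℝ k.rkhs X ℝ :=
  inferInstanceAs (RKHS ℝ (RKHS.OfKernel k.opKernel) X ℝ)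

theorem kernel_rkhs : RKHS.kernel k.rkhs = k.opKernel :=
  RKHS.OfKernel.kernel_ofKernel (K := k.opKernel)

/-- The feature map `φ x = k(·, x)`. -/
noncomputable def feature (x : X) : k.rkhs := RKHS.kerFun k.rkhs x (1 : ℝ)

theorem feature_apply (x y : X) : k.feature x y = k.toFun y x := by
  rw [feature, RKHS.kerFun_apply, kernel_rkhs]
  simp [opKernel]

theorem inner_feature (x : X) (h : k.rkhs) : inner ℝ h (k.feature x) = h x := by
  simp [feature]

theorem inner_feature_feature (x y : X) :
    inner ℝ (k.feature x) (k.feature y) = k.toFun x y := by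
  rw [inner_feature, feature_apply]
  exact k.posSemidef.1.apply x y

end RKHS

/-- Gram matrices are positive semidefinite. -/
theorem posSemidef_gram {X E : Type*} [NormedAddCommGroup E] [InnerProductSpace ℝ E] (v : X → E) :
    (Matrix.of fun x y => inner ℝ (v x) (v y)).PosSemidef := by
  refine ⟨?_, fun c => ?_⟩
  · ext p q
    exact real_inner_comm (v p) (v q)
  · have h := real_inner_self_nonneg (x := ∑ p ∈ c.support, c p • v p)
    refine h.trans_eq ?_
    rw [sum_inner]
    refine Finset.sum_congr rfl fun i _ => ?_
    rw [inner_sum]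
    refine Finset.sum_congr rfl fun j _ => ?_
    rw [real_inner_smul_left, real_inner_smul_right]
    simp only [Matrix.of_apply, star_trivial]
    ring

open scoped TensorProduct in
/-- The product kernel `((x, y), (x', y')) ↦ k₁ x x' * k₂ y y'`. -/
noncomputable def prod {X Y : Type*} [TopologicalSpace X] [TopologicalSpace Y]
    (k₁ : PDKernel X) (k₂ : PDKernel Y) : PDKernel (X × Y) where
  toFun p q := k₁.toFun p.1 q.1 * k₂.toFun p.2 q.2
  continuous_toFun :=
    (k₁.continuous_toFun.comp (by fun_prop : Continuous fun p : (X × Y) × X × Y =>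
      (p.1.1, p.2.1))).mul
    (k₂.continuous_toFun.comp (by fun_prop : Continuous fun p : (X × Y) × X × Y =>
      (p.1.2, p.2.2)))
  posSemidef := by
    have hv (p q : X × Y) : k₁.toFun p.1 q.1 * k₂.toFun p.2 q.2 =
        inner ℝ (k₁.feature p.1 ⊗ₜ[ℝ] k₂.feature p.2) (k₁.feature q.1 ⊗ₜ[ℝ] k₂.feature q.2) := by
      rw [TensorProduct.inner_tmul, inner_feature_feature, inner_feature_feature]
    have h := posSemidef_gram fun p : X × Y => k₁.feature p.1 ⊗ₜ[ℝ] k₂.feature p.2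
    simpa only [← hv] using h
  diag_eq_one p := by rw [k₁.diag_eq_one, k₂.diag_eq_one, one_mul]

/-- The covariance operator `Σ_p = ∫ φ(x) φ(x)^* dp(x)` (a Bochner integral of rank-one operators,
for the operator norm) of a measure `p`. -/
noncomputable def covariance {X : Type*} [TopologicalSpace X] [MeasurableSpace X]
    (k : PDKernel X) (p : MeasureTheory.Measure X) : k.rkhs →L[ℝ] k.rkhs :=
  ∫ x, InnerProductSpace.rankOne ℝ (k.feature x) (k.feature x) ∂p

end PDKernel

/-! ### The regularized quantum Rényi divergence -/

section Renyi

open scoped ENNReal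

variable {H : Type*} [NormedAddCommGroup H] [InnerProductSpace ℝ H] [CompleteSpace H]

/-- The trace `∑ ⟨e, T e⟩ ∈ [0, ∞]` of a positive operator, over an orthonormal (Hilbert) basis
of `H`; for positive `T` the value does not depend on the basis. -/
noncomputable def opTrace (T : H →L[ℝ] H) : ℝ≥0∞ :=
  ∑' e : (exists_hilbertBasis ℝ H).choose, ENNReal.ofReal (inner ℝ (e : H) (T e))

/-- The power `T ^ r`, `0 < r`, of a positive operator, by continuous functional calculus. -/
noncomputable def opPow (T : H →L[ℝ] H) (r : ℝ) : H →L[ℝ] H :=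
  cfc (fun t : ℝ => t ^ r) T

/-- `tr[(B^((1-α)/(2α)) A B^((1-α)/(2α)))^α] ∈ [0, ∞]` for positive `A`, `B`.

For `α > 1` the exponent is negative and `B` need not be invertible. The sandwiched operator
`τ = B^((1-α)/(2α)) A B^((1-α)/(2α))` is then the unique positive `τ` that vanishes on `ker B`
and satisfies `B^((α-1)/(2α)) τ B^((α-1)/(2α)) = A`; if there is none (for example if `ker B`
is not contained in `ker A`), the value is `∞`. -/
noncomputable def sandwichedTrace (α : ℝ) (A B : H →L[ℝ] H) : ℝ≥0∞ :=
  if α < 1 then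
    opTrace (opPow (opPow B ((1 - α) / (2 * α)) ∘L A ∘L opPow B ((1 - α) / (2 * α))) α)
  else
    ⨅ τ ∈ {τ : H →L[ℝ] H | τ.IsPositive ∧ (∀ x, B x = 0 → τ x = 0) ∧
      opPow B ((α - 1) / (2 * α)) ∘L τ ∘L opPow B ((α - 1) / (2 * α)) = A},
      opTrace (opPow τ α)

/-- The order-`α` quantum Rényi divergence
`D_α(A‖B) = (α - 1)⁻¹ log (tr[(B^((1-α)/(2α)) A B^((1-α)/(2α)))^α] / tr[A]) ∈ [-∞, ∞]`. -/
noncomputable def quantumRenyi (α : ℝ) (A B : H →L[ℝ] H) : EReal :=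
  ((α - 1)⁻¹ : ℝ) * ENNReal.log (sandwichedTrace α A B / opTrace A)

/-- The regularized quantum Rényi divergence `D_{α,λ}(A‖B) = D_α(A‖B + λ Id)`. -/
noncomputable def regQuantumRenyi (α lam : ℝ) (A B : H →L[ℝ] H) : EReal :=
  quantumRenyi α A (B + lam • ContinuousLinearMap.id ℝ H)

end Renyi

/-- `(k, α, λ, ε)`-regularized kernel Rényi differential privacy of a randomized mechanism
`f : 𝒟 → R`, given by the random variables `f D : Ω → R` on a probability space `(Ω, μ)`,
with respect to an adjacency relation on `𝒟`. -/
def RKRDP {𝒟 Ω R : Type*} [MeasurableSpace Ω] [TopologicalSpace R] [MeasurableSpace R]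
    (μ : MeasureTheory.Measure Ω) (adj : 𝒟 → 𝒟 → Prop)
    (k : PDKernel R) (α lam ε : ℝ) (f : 𝒟 → Ω → R) : Prop :=
  ∀ D D' : 𝒟, adj D D' →
    regQuantumRenyi α lam (k.covariance (μ.map (f D))) (k.covariance (μ.map (f D'))) ≤ (ε : EReal)

set_option linter.unusedSectionVars false

/-! The elementary tensors of features and the features of the product kernel have the same Gram
matrix, so the RKHS of the product kernel is a completion of the tensor product of the two RKHSs.
Independence makes the joint law a product measure, and Fubini turns its covariance operator into
the tensor product of the two covariance operators (`PDKernel.covariance_prod`). Traces of powers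
are multiplicative on tensor products, so the only loss comes from the regularization: `C = B₁ ⊗ B₂
+ λ` has to be compared with `(B₁ + λ/3) ⊗ (B₂ + λ/3)`.

Since `k x x = 1`, covariances have trace one, so their eigenvalues `x`, `y` lie in `[0, 1]`, and
for `λ ≤ 3` one has `(x + λ/3)(y + λ/3) ≤ xy + λ`. Both operators are diagonal in the same tensor
basis, so the inequality passes to all nonnegative powers without any operator monotonicity
(`abs_rpow_mul_rpow_le`).

It reaches the divergence because `tr[(S A S)^p] = tr[(A^(1/2) S² A^(1/2))^p]` is monotone in `S²`
for every `p > 0` (`opTrace_opPow_sandwich_le`). For `α < 1` this bounds the sandwiched trace from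
below, which is the right direction as `α - 1 < 0` (`le_sandwichedTrace_of_isDiag`). For `α > 1` the
tensor product of two admissible `τ₁`, `τ₂` becomes admissible for `C` after conjugation by a
diagonal contraction, which does not increase the trace (`sandwichedTrace_le_of_isDiag`).

If `λ > 3`, then `C ≥ Id`, so the divergence is at most `0`, and `0 ≤ ε₁ + ε₂` suffices. -/

namespace HilbertOp

open scoped ENNReal

/-! ### Functional calculus, powers and traces of positive operators -/

section

variable {H : Type*} [NormedAddCommGroup H] [InnerProductSpace ℝ H] [CompleteSpace H]

/-- True for constants and for the identity, stable under sums, products and uniform limits, hence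
true for every continuous function on the spectrum by Stone–Weierstrass. A nonzero eigenvector puts
`m` in the spectrum, where these functions live. -/
theorem cfc_apply_eigenvector {T : H →L[ℝ] H} (hT : IsSelfAdjoint T) {f : ℝ → ℝ}
    (hf : Continuous f) {m : ℝ} {v : H} (hv : T v = m • v) : cfc f T v = f m • v := by
  rcases eq_or_ne v 0 with rfl | h0
  · simp
  have hm : m ∈ spectrum ℝ T := by
    rw [spectrum.mem_iff]
    intro hu
    obtain ⟨d, hd⟩ := hu.exists_left_inv
    have h1 : (d * (algebraMap ℝ (H →L[ℝ] H) m - T)) v = v := by rw [hd]; rfl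
    apply h0
    rw [← h1]
    simp [Algebra.algebraMap_eq_smul_one, hv]
  rw [cfc_apply f T hT hf.continuousOn]
  have key : ∀ g : C(spectrum ℝ T, ℝ), cfcHom hT g v = g ⟨m, hm⟩ • v := by
    have hc := cfcHom_continuous hT (R := ℝ)
    refine ContinuousMap.induction_on_of_compact (𝕜 := ℝ) (fun r => ?_) ?_ ?_
      (fun f g hf hg => ?_) (fun f g hf hg => ?_) fun f h => ?_
    · change cfcHom hT (algebraMap ℝ C(spectrum ℝ T, ℝ) r) v = _
      rw [AlgHomClass.commutes]
      simp [Algebra.algebraMap_eq_smul_one]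
    · rw [cfcHom_id]
      exact hv
    · rw [star_trivial, cfcHom_id]
      exact hv
    · rw [map_add, add_apply, hf, hg, ContinuousMap.add_apply, add_smul]
    · rw [map_mul, mul_apply_eq_comp, hg, map_smul, hf, smul_smul, ContinuousMap.mul_apply,
        mul_comm]
    · have hcl : IsClosed {g : C(spectrum ℝ T, ℝ) | cfcHom hT g v = g ⟨m, hm⟩ • v} :=
        isClosed_eq (by fun_prop) (by fun_prop)
      exact h.mem_of_closed hcl
  rw [key]
  rfl

theorem isSelfAdjoint_cfc (f : ℝ → ℝ) (T : H →L[ℝ] H) : IsSelfAdjoint (cfc f T) :=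
  cfc_predicate f T

theorem spectrum_nonneg {T : H →L[ℝ] H} (hT : T.IsPositive) {t : ℝ} (ht : t ∈ spectrum ℝ T) :
    0 ≤ t :=
  spectrum_nonneg_of_nonneg ((ContinuousLinearMap.nonneg_iff_isPositive T).2 hT) ht

theorem isPositive_of_inner_nonneg {T : H →L[ℝ] H} (hT : IsSelfAdjoint T)
    (h : ∀ x, 0 ≤ inner ℝ (T x) x) : T.IsPositive :=
  ContinuousLinearMap.isPositive_def'.2 ⟨hT, fun x => h x⟩

theorem isPositive_sandwich {A S : H →L[ℝ] H} (hA : A.IsPositive) (hS : IsSelfAdjoint S) :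
    (S ∘L A ∘L S).IsPositive := by
  have := hA.conj_adjoint S
  rwa [hS.adjoint_eq] at this

theorem isPositive_cfc {f : ℝ → ℝ} (hf : Continuous f) {T : H →L[ℝ] H}
    (h : ∀ t ∈ spectrum ℝ T, 0 ≤ f t) : (cfc f T).IsPositive := by
  rw [← ContinuousLinearMap.nonneg_iff_isPositive]
  have : cfc f T = cfc (fun t => √(f t)) T * cfc (fun t => √(f t)) T := by
    rw [← cfc_mul _ _ _ (by fun_prop) (by fun_prop)]
    exact cfc_congr fun t ht => (Real.mul_self_sqrt (h t ht)).symm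
  rw [this, ContinuousLinearMap.nonneg_iff_isPositive]
  have := ContinuousLinearMap.isPositive_adjoint_comp_self (cfc (fun t => √(f t)) T)
  rwa [(isSelfAdjoint_cfc _ T).adjoint_eq] at this

theorem isPositive_opPow {T : H →L[ℝ] H} (hT : T.IsPositive) {r : ℝ} (hr : 0 ≤ r) :
    (opPow T r).IsPositive :=
  isPositive_cfc (Real.continuous_rpow_const hr)
    fun _ ht => Real.rpow_nonneg (spectrum_nonneg hT ht) r

theorem isSelfAdjoint_opPow (T : H →L[ℝ] H) (r : ℝ) : IsSelfAdjoint (opPow T r) :=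
  isSelfAdjoint_cfc _ T

theorem opPow_half_mul_self {T : H →L[ℝ] H} (hT : T.IsPositive) {r : ℝ} (hr : 0 < r) :
    opPow T (r / 2) ∘L opPow T (r / 2) = opPow T r := by
  have hc : Continuous fun t : ℝ => t ^ (r / 2) := Real.continuous_rpow_const (by positivity)
  refine (cfc_mul _ _ T hc.continuousOn hc.continuousOn).symm.trans ?_
  refine cfc_congr fun t ht => ?_
  change t ^ (r / 2) * t ^ (r / 2) = t ^ r
  rw [← Real.rpow_add_of_nonneg (spectrum_nonneg hT ht) (by positivity) (by positivity)]
  congr 1; ring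

theorem opPow_one {T : H →L[ℝ] H} (hT : T.IsPositive) : opPow T 1 = T := by
  unfold opPow
  simp only [Real.rpow_one]
  exact cfc_id' ℝ T hT.isSelfAdjoint

theorem opPow_opPow {T : H →L[ℝ] H} (hT : T.IsPositive) {r s : ℝ} (hr : 0 < r) (hs : 0 < s) :
    opPow (opPow T r) s = opPow T (r * s) := by
  have hcr : Continuous fun t : ℝ => t ^ r := Real.continuous_rpow_const hr.le
  have hcs : Continuous fun t : ℝ => t ^ s := Real.continuous_rpow_const hs.le
  unfold opPow
  rw [← cfc_comp' _ _ T (hcs.continuousOn) hcr.continuousOn hT.isSelfAdjoint]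
  exact cfc_congr fun t ht => (Real.rpow_mul (spectrum_nonneg hT ht) r s).symm

theorem opPow_apply_eigenvector {T : H →L[ℝ] H} (hT : IsSelfAdjoint T) {r : ℝ} (hr : 0 ≤ r)
    {m : ℝ} {v : H} (hv : T v = m • v) : opPow T r v = (m ^ r) • v :=
  cfc_apply_eigenvector hT (Real.continuous_rpow_const hr) hv

/-! #### Traces -/

theorem tsum_inner_sq {ι : Type*} (b : HilbertBasis ι ℝ H) (x : H) :
    ∑' i, ENNReal.ofReal (inner ℝ (b i) x ^ 2) = ENNReal.ofReal (‖x‖ ^ 2) := by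
  have h := b.hasSum_inner_mul_inner x x
  have h2 : ∀ i, inner ℝ x (b i) * inner ℝ (b i) x = inner ℝ (b i) x ^ 2 := fun i => by
    rw [real_inner_comm x, pow_two]
  simp only [h2, real_inner_self_eq_norm_sq] at h
  rw [← ENNReal.ofReal_tsum_of_nonneg (fun i => sq_nonneg _) h.summable, h.tsum_eq]

/-- Parseval turns both sides into the double sum of squared matrix entries. Applied to a square
root, this gives the basis independence of the trace. -/
theorem tsum_norm_sq_adjoint {ι κ : Type*} (b : HilbertBasis ι ℝ H) (c : HilbertBasis κ ℝ H)
    (N : H →L[ℝ] H) :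
    ∑' i, ENNReal.ofReal (‖N (b i)‖ ^ 2) =
      ∑' j, ENNReal.ofReal (‖N.adjoint (c j)‖ ^ 2) := by
  simp_rw [← tsum_inner_sq c (N _), ← tsum_inner_sq b (N.adjoint _)]
  rw [ENNReal.tsum_comm]
  simp_rw [ContinuousLinearMap.adjoint_inner_right, real_inner_comm]

theorem inner_eq_norm_opPow_half {T : H →L[ℝ] H} (hT : T.IsPositive) (x : H) :
    inner ℝ x (T x) = ‖opPow T (1 / 2) x‖ ^ 2 := by
  conv_lhs => rw [← opPow_one hT, ← opPow_half_mul_self hT one_pos]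
  rw [← real_inner_self_eq_norm_sq]
  exact ((isSelfAdjoint_opPow T (1 / 2)).isSymmetric.apply_clm x _).symm

theorem tsum_inner_eq_tsum_inner {ι κ : Type*} {T : H →L[ℝ] H} (hT : T.IsPositive)
    (b : HilbertBasis ι ℝ H) (c : HilbertBasis κ ℝ H) :
    ∑' i, ENNReal.ofReal (inner ℝ (b i) (T (b i))) =
      ∑' j, ENNReal.ofReal (inner ℝ (c j) (T (c j))) := by
  simp_rw [inner_eq_norm_opPow_half hT]
  rw [tsum_norm_sq_adjoint b c, (isSelfAdjoint_opPow T (1 / 2)).adjoint_eq]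

theorem opTrace_eq_tsum {ι : Type*} {T : H →L[ℝ] H} (hT : T.IsPositive) (b : HilbertBasis ι ℝ H) :
    opTrace T = ∑' i, ENNReal.ofReal (inner ℝ (b i) (T (b i))) := by
  obtain ⟨c, hc⟩ := (exists_hilbertBasis ℝ H).choose_spec
  rw [tsum_inner_eq_tsum_inner hT b c, opTrace]
  simp only [hc]

/-- `T` is diagonal with entries `m` in the Hilbert basis `b`. -/
def IsDiag {ι : Type*} (T : H →L[ℝ] H) (b : HilbertBasis ι ℝ H) (m : ι → ℝ) : Prop :=
  ∀ i, T (b i) = m i • b i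

theorem IsDiag.inner_eq {ι : Type*} {T : H →L[ℝ] H} {b : HilbertBasis ι ℝ H} {m : ι → ℝ}
    (h : IsDiag T b m) (i : ι) : inner ℝ (b i) (T (b i)) = m i := by
  rw [h i, inner_smul_right, real_inner_self_eq_norm_sq, b.orthonormal.1 i]
  simp

theorem IsDiag.nonneg {ι : Type*} {T : H →L[ℝ] H} {b : HilbertBasis ι ℝ H} {m : ι → ℝ}
    (h : IsDiag T b m) (hT : T.IsPositive) (i : ι) : 0 ≤ m i := by
  rw [← h.inner_eq i]
  exact hT.inner_nonneg_right _

theorem IsDiag.opPow {ι : Type*} {T : H →L[ℝ] H} {b : HilbertBasis ι ℝ H} {m : ι → ℝ}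
    (h : IsDiag T b m) (hT : IsSelfAdjoint T) {r : ℝ} (hr : 0 ≤ r) :
    IsDiag (opPow T r) b fun i => m i ^ r :=
  fun i => opPow_apply_eigenvector hT hr (h i)

theorem IsDiag.opTrace_opPow {ι : Type*} {T : H →L[ℝ] H} {b : HilbertBasis ι ℝ H} {m : ι → ℝ}
    (h : IsDiag T b m) (hT : T.IsPositive) {r : ℝ} (hr : 0 ≤ r) :
    opTrace (_root_.opPow T r) = ∑' i, ENNReal.ofReal (m i ^ r) := by
  rw [opTrace_eq_tsum (isPositive_opPow hT hr) b]
  simp_rw [(h.opPow hT.isSelfAdjoint hr).inner_eq]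

theorem hilbertBasis_ext {ι : Type*} (b : HilbertBasis ι ℝ H) {x y : H}
    (h : ∀ i, inner ℝ (b i) x = inner ℝ (b i) y) : x = y := by
  apply b.repr.injective
  ext i
  rw [b.repr_apply_apply, b.repr_apply_apply, h]

theorem hilbertBasis_ext_clm {ι : Type*} (b : HilbertBasis ι ℝ H) {S T : H →L[ℝ] H}
    (h : ∀ i, S (b i) = T (b i)) : S = T := by
  ext x
  have h1 := (b.hasSum_repr x).mapL S
  have h2 := (b.hasSum_repr x).mapL T
  simp only [map_smul, h] at h1 h2
  exact h1.unique h2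

theorem IsDiag.isSelfAdjoint {ι : Type*} {T : H →L[ℝ] H} {b : HilbertBasis ι ℝ H} {m : ι → ℝ}
    (h : IsDiag T b m) : IsSelfAdjoint T := by
  rw [ContinuousLinearMap.isSelfAdjoint_iff']
  refine hilbertBasis_ext_clm b fun i => hilbertBasis_ext b fun j => ?_
  rw [ContinuousLinearMap.adjoint_inner_right, h j, h i, inner_smul_left, inner_smul_right]
  classical
  rw [orthonormal_iff_ite.1 b.orthonormal j i]
  split_ifs with hij
  · subst hij; simp
  · simp

theorem IsDiag.inner_apply {ι : Type*} {T : H →L[ℝ] H} {b : HilbertBasis ι ℝ H} {m : ι → ℝ}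
    (h : IsDiag T b m) (x : H) (i : ι) : inner ℝ (b i) (T x) = m i * inner ℝ (b i) x := by
  rw [← h.isSelfAdjoint.isSymmetric.apply_clm, h i, real_inner_smul_left]

theorem IsDiag.ofReal_norm_sq {ι : Type*} {T : H →L[ℝ] H} {b : HilbertBasis ι ℝ H} {m : ι → ℝ}
    (h : IsDiag T b m) (x : H) :
    ENNReal.ofReal (‖T x‖ ^ 2) = ∑' i, ENNReal.ofReal (m i ^ 2 * inner ℝ (b i) x ^ 2) := by
  rw [← tsum_inner_sq b]
  simp_rw [h.inner_apply, mul_pow]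

/-- Parseval, coordinate by coordinate. This is how an inequality between eigenvalues becomes the
operator inequality `S² ≤ T²`. -/
theorem IsDiag.norm_apply_le {ι : Type*} {S T : H →L[ℝ] H} {b : HilbertBasis ι ℝ H} {m n : ι → ℝ}
    (hS : IsDiag S b m) (hT : IsDiag T b n) (h : ∀ i, |m i| ≤ |n i|) (x : H) :
    ‖S x‖ ≤ ‖T x‖ := by
  rw [← sq_le_sq₀ (norm_nonneg _) (norm_nonneg _), ← ENNReal.ofReal_le_ofReal_iff (sq_nonneg _),
    hS.ofReal_norm_sq, hT.ofReal_norm_sq]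
  refine ENNReal.tsum_le_tsum fun i => ENNReal.ofReal_le_ofReal ?_
  exact mul_le_mul_of_nonneg_right (sq_le_sq.2 (h i)) (sq_nonneg _)

end

/-! ### Compactness and diagonalization -/

section

variable {H : Type*} [NormedAddCommGroup H] [InnerProductSpace ℝ H] [CompleteSpace H]

theorem isCompactOperator_rankOne (u v : H) :
    IsCompactOperator (InnerProductSpace.rankOne ℝ u v : H →L[ℝ] H) := by
  have h : IsCompactOperator (ContinuousLinearMap.toSpanSingleton ℝ u) :=
    isCompactOperator_of_locallyCompactSpace_rng _
  exact h.comp_clm (innerSL ℝ v)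

/-- The orthogonal projection onto the span of finitely many basis vectors. -/
noncomputable def finProj {ι : Type*} (b : HilbertBasis ι ℝ H) (F : Finset ι) : H →L[ℝ] H :=
  ∑ i ∈ F, InnerProductSpace.rankOne ℝ (b i) (b i)

theorem isCompactOperator_finProj {ι : Type*} (b : HilbertBasis ι ℝ H) (F : Finset ι) :
    IsCompactOperator (finProj b F) := by
  have : finProj b F ∈ compactOperator (RingHom.id ℝ) H H :=
    Submodule.sum_mem _ fun i _ => isCompactOperator_rankOne _ _
  exact this

open Classical in
theorem finProj_apply_basis {ι : Type*} (b : HilbertBasis ι ℝ H) (F : Finset ι) (i : ι) :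
    finProj b F (b i) = if i ∈ F then b i else 0 := by
  simp only [finProj, sum_apply, InnerProductSpace.rankOne_apply,
    orthonormal_iff_ite.1 b.orthonormal]
  simp

theorem norm_adjoint_apply_sq_le {ι : Type*} (b : HilbertBasis ι ℝ H) {N : H →L[ℝ] H}
    (hN : Summable fun i => ‖N (b i)‖ ^ 2) (y : H) :
    ‖N.adjoint y‖ ^ 2 ≤ (∑' i, ‖N (b i)‖ ^ 2) * ‖y‖ ^ 2 := by
  rw [← ENNReal.ofReal_le_ofReal_iff (by positivity), ← tsum_inner_sq b, ← tsum_mul_right,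
    ENNReal.ofReal_tsum_of_nonneg (fun i => by positivity) (hN.mul_right _)]
  refine ENNReal.tsum_le_tsum fun i => ENNReal.ofReal_le_ofReal ?_
  rw [ContinuousLinearMap.adjoint_inner_right, ← mul_pow]
  exact sq_le_sq.2 ((abs_real_inner_le_norm _ _).trans (le_abs_self _))

theorem norm_le_sqrt_tsum {ι : Type*} (b : HilbertBasis ι ℝ H) {N : H →L[ℝ] H}
    (hN : Summable fun i => ‖N (b i)‖ ^ 2) : ‖N‖ ≤ √(∑' i, ‖N (b i)‖ ^ 2) := by
  rw [← LinearIsometryEquiv.norm_map (ContinuousLinearMap.adjoint (𝕜 := ℝ) (E := H) (F := H)) N]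
  refine ContinuousLinearMap.opNorm_le_bound _ (Real.sqrt_nonneg _) fun y => ?_
  have h := Real.sqrt_le_sqrt (norm_adjoint_apply_sq_le b hN y)
  rwa [Real.sqrt_sq (norm_nonneg _), Real.sqrt_mul (tsum_nonneg fun i => by positivity),
    Real.sqrt_sq (norm_nonneg _)] at h

/-- A Hilbert–Schmidt operator is the limit of its finite-rank truncations: the operator norm of the
difference is at most its Hilbert–Schmidt norm, the tail of a convergent series. -/
theorem isCompactOperator_of_summable_norm_sq {ι : Type*} (b : HilbertBasis ι ℝ H) {N : H →L[ℝ] H}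
    (hN : Summable fun i => ‖N (b i)‖ ^ 2) : IsCompactOperator N := by
  classical
  have hF (F : Finset ι) (i : ι) : ‖(N ∘L finProj b F - N) (b i)‖ ^ 2 =
      if i ∈ F then 0 else ‖N (b i)‖ ^ 2 := by
    rw [sub_apply, ContinuousLinearMap.comp_apply, finProj_apply_basis]
    split_ifs <;> simp
  have hs (F : Finset ι) : Summable fun i => ‖(N ∘L finProj b F - N) (b i)‖ ^ 2 := by
    refine hN.of_nonneg_of_le (fun i => by positivity) fun i => ?_
    rw [hF]
    split_ifs
    · positivity
    · exact le_rfl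
  have ht : Filter.Tendsto (fun F : Finset ι => √(∑' i, ‖(N ∘L finProj b F - N) (b i)‖ ^ 2))
      Filter.atTop (nhds 0) := by
    have h0 := (tendsto_tsum_compl_atTop_zero fun i => ‖N (b i)‖ ^ 2).sqrt
    rw [Real.sqrt_zero] at h0
    refine h0.congr fun F => ?_
    congr 1
    simp_rw [hF]
    have := tsum_subtype {i | i ∉ F} fun i => ‖N (b i)‖ ^ 2
    refine this.trans (tsum_congr fun i => ?_)
    simp only [Set.indicator, Set.mem_ofPred_eq]
    split_ifs <;> rfl
  refine isCompactOperator_of_tendsto (l := Filter.atTop)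
    (F := fun F : Finset ι => N ∘L finProj b F) ?_ (Filter.Eventually.of_forall fun F => ?_)
  · rw [tendsto_iff_norm_sub_tendsto_zero]
    exact squeeze_zero (fun _ => norm_nonneg _) (fun F => norm_le_sqrt_tsum b (hs F)) ht
  · exact (isCompactOperator_finProj b F).clm_comp N

theorem IsDiag.norm_le {ι : Type*} {T : H →L[ℝ] H} {b : HilbertBasis ι ℝ H} {m : ι → ℝ}
    (h : IsDiag T b m) {c : ℝ} (hc : 0 ≤ c) (hm : ∀ i, |m i| ≤ c) : ‖T‖ ≤ c := by
  refine T.opNorm_le_bound hc fun x => ?_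
  have h1 : IsDiag (c • ContinuousLinearMap.id ℝ H) b fun _ => c := fun i => rfl
  have := h.norm_apply_le h1 (fun i => by rw [abs_of_nonneg hc]; exact hm i) x
  rwa [smul_apply, ContinuousLinearMap.id_apply, norm_smul, Real.norm_of_nonneg hc] at this

theorem IsDiag.isCompactOperator {ι : Type*} {T : H →L[ℝ] H} {b : HilbertBasis ι ℝ H} {m : ι → ℝ}
    (h : IsDiag T b m) (hm : Filter.Tendsto m Filter.cofinite (nhds 0)) :
    IsCompactOperator T := by
  classical
  have hcl := isClosed_setOfPred_isCompactOperator (σ₁₂ := RingHom.id ℝ) (M₁ := H) (M₂ := H)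
  refine hcl.closure_subset (Metric.mem_closure_iff.2 fun ε hε => ?_)
  have hfin : {i | ¬ |m i| ≤ ε / 2}.Finite := by
    have := (Metric.tendsto_nhds.1 hm) (ε / 2) (by positivity)
    refine this.mono fun i hi => ?_
    rw [Real.dist_eq, sub_zero] at hi
    exact hi.le
  refine ⟨T ∘L finProj b hfin.toFinset, (isCompactOperator_finProj b _).clm_comp T, ?_⟩
  rw [dist_eq_norm]
  have hd : IsDiag (T - T ∘L finProj b hfin.toFinset) b
      fun i => if i ∈ hfin.toFinset then 0 else m i := by
    intro i
    rw [sub_apply, ContinuousLinearMap.comp_apply, finProj_apply_basis]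
    split_ifs with hi
    · simp only [if_pos hi, sub_self, zero_smul]
    · simp only [if_neg hi, map_zero, sub_zero, h i]
  refine (hd.norm_le (c := ε / 2) (by positivity) fun i => ?_).trans_lt (by linarith)
  split_ifs with hi
  · simp; positivity
  · simpa using hi

universe u in
-- Spectral theorem in basis form: Hilbert bases of all the eigenspaces, the kernel included, are
-- glued together. The result is total because the eigenspaces of a compact self-adjoint operator
-- have trivial common orthogonal complement.
theorem exists_isDiag {H : Type u} [NormedAddCommGroup H] [InnerProductSpace ℝ H]
    [CompleteSpace H] {T : H →L[ℝ] H} (hc : IsCompactOperator T) (hT : IsSelfAdjoint T) :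
    ∃ (ι : Type u) (b : HilbertBasis ι ℝ H) (m : ι → ℝ), IsDiag T b m := by
  let G : ℝ → Submodule ℝ H := fun r => Module.End.eigenspace (T : Module.End ℝ H) r
  have hGc (r : ℝ) : CompleteSpace (G r) := by
    have : IsClosed (G r : Set H) := by
      have : (G r : Set H) = {x | T x = r • x} := by
        ext x
        simp [G]
      rw [this]
      exact isClosed_eq (by fun_prop) (by fun_prop)
    exact this.completeSpace_coe
  choose w b hb using fun r => exists_hilbertBasis ℝ (G r)
  have hO : OrthogonalFamily ℝ (fun r => G r) fun r => (G r).subtypeₗᵢ :=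
    hT.isSymmetric.orthogonalFamily_eigenspaces
  have hv := hO.orthonormal_sigma_orthonormal (v_family := fun r => b r)
    fun r => (b r).orthonormal
  have hsp : (Submodule.span ℝ (Set.range fun a : Σ r, w r =>
      (G a.1).subtypeₗᵢ (b a.1 a.2)))ᗮ = ⊥ := by
    rw [eq_bot_iff, ← ContinuousLinearMap.orthogonalComplement_iSup_eigenspaces_eq_bot hc
      hT.isSymmetric]
    intro x hx
    rw [Submodule.mem_orthogonal]
    have hx' (r : ℝ) (i : w r) : inner ℝ (b r i : H) x = 0 :=
      (Submodule.mem_orthogonal _ _).1 hx _ (Submodule.subset_span ⟨⟨r, i⟩, rfl⟩)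
    intro u hu
    refine Submodule.iSup_induction _ (motive := fun u => inner ℝ u x = 0) hu (fun r y hy => ?_)
      (inner_zero_left _) fun y z hy hz => by rw [inner_add_left, hy, hz, add_zero]
    have hs := (((b r).hasSum_repr ⟨y, hy⟩).mapL (G r).subtypeL).mapL (innerSL ℝ x)
    have hz (i : w r) : innerSL ℝ x ((G r).subtypeL ((b r).repr ⟨y, hy⟩ i • b r i)) = 0 := by
      rw [map_smul, map_smul]
      have : innerSL ℝ x ((G r).subtypeL (b r i)) = 0 := (real_inner_comm _ _).trans (hx' r i)
      rw [this, smul_zero]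
    simp only [hz] at hs
    exact (real_inner_comm _ _).trans (hs.unique hasSum_zero)
  refine ⟨Σ r, w r, HilbertBasis.mkOfOrthogonalEqBot hv hsp, fun a => a.1, fun a => ?_⟩
  rw [HilbertBasis.coe_mkOfOrthogonalEqBot]
  exact Module.End.mem_eigenspace_iff.1 (b a.1 a.2).2

/-- `T^(r/2)` is Hilbert–Schmidt, so `T^r` is compact and diagonalizable with summable eigenvalues.
Then `T = (T^r)^(1/r)` is diagonal in the same basis, with entries tending to zero. -/
theorem isCompactOperator_of_opTrace_opPow {T : H →L[ℝ] H} (hT : T.IsPositive) {r : ℝ} (hr : 0 < r)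
    (h : opTrace (opPow T r) ≠ ⊤) : IsCompactOperator T := by
  obtain ⟨w, b, -⟩ := exists_hilbertBasis ℝ H
  have hP := isPositive_opPow hT hr.le
  have hR : IsCompactOperator (opPow T (r / 2)) := by
    refine isCompactOperator_of_summable_norm_sq b ?_
    rw [opTrace_eq_tsum hP b] at h
    refine (ENNReal.summable_toReal h).congr fun i => ?_
    rw [ENNReal.toReal_ofReal (hP.inner_nonneg_right _), ← opPow_half_mul_self hT hr,
      ← real_inner_self_eq_norm_sq]
    exact ((isSelfAdjoint_opPow T (r / 2)).isSymmetric.apply_clm (b i) _).symm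
  have hRR : IsCompactOperator (opPow T r) := by
    rw [← opPow_half_mul_self hT hr]
    exact hR.clm_comp _
  obtain ⟨ι, c, m, hm⟩ := exists_isDiag hRR hP.isSelfAdjoint
  have hm0 := hm.nonneg hP
  have hd := hm.opPow hP.isSelfAdjoint (one_div_nonneg.2 hr.le)
  rw [opPow_opPow hT hr (by positivity), mul_one_div_cancel hr.ne', opPow_one hT] at hd
  refine hd.isCompactOperator ?_
  have hs : Summable m := by
    rw [opTrace_eq_tsum hP c] at h
    refine (ENNReal.summable_toReal h).congr fun i => ?_
    rw [ENNReal.toReal_ofReal (hP.inner_nonneg_right _), hm.inner_eq]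
  have := (Real.continuous_rpow_const (one_div_nonneg.2 hr.le)).tendsto 0
  rw [Real.zero_rpow (by positivity)] at this
  exact this.comp hs.tendsto_cofinite_zero

/-! #### Jensen's inequality and monotonicity of trace functionals -/

theorem inner_cfc_affine {Y : H →L[ℝ] H} (hY : IsSelfAdjoint Y) (c d : ℝ) {x : H}
    (hx : ‖x‖ = 1) : inner ℝ x (cfc (fun t => c + d * t) Y x) = c + d * inner ℝ x (Y x) := by
  rw [cfc_const_add c _ Y (by fun_prop) hY, cfc_const_mul_id d Y hY]
  simp [Algebra.algebraMap_eq_smul_one, inner_add_right, inner_smul_right, hx]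

theorem inner_cfc_le_inner_cfc {Y : H →L[ℝ] H} {f g : ℝ → ℝ}
    (hf : Continuous f) (hg : Continuous g) (h : ∀ t ∈ spectrum ℝ Y, f t ≤ g t) (x : H) :
    inner ℝ x (cfc f Y x) ≤ inner ℝ x (cfc g Y x) := by
  have hp := isPositive_cfc (hg.sub hf) (T := Y) fun t ht => sub_nonneg.2 (h t ht)
  have h0 := hp.inner_nonneg_right x
  change 0 ≤ inner ℝ x (cfc (fun t => g t - f t) Y x) at h0
  rw [cfc_sub g f Y hg.continuousOn hf.continuousOn, sub_apply, inner_sub_right] at h0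
  linarith

theorem apply_eq_zero_of_inner_eq_zero {Y : H →L[ℝ] H} (hY : Y.IsPositive) {x : H}
    (h : inner ℝ x (Y x) = 0) : Y x = 0 := by
  rw [inner_eq_norm_opPow_half hY] at h
  have h1 : opPow Y (1 / 2) x = 0 := by simpa using h
  rw [← opPow_one hY, ← opPow_half_mul_self hY one_pos, ContinuousLinearMap.comp_apply, h1,
    map_zero]

theorem tangent_mul {p m t : ℝ} (hm : 0 < m) (ht : 0 ≤ t) :
    t ^ p = m ^ p * (1 + (t / m - 1)) ^ p := by
  rw [add_sub_cancel, ← Real.mul_rpow hm.le (by positivity), mul_div_cancel₀ _ hm.ne']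

/-- Jensen for the spectral measure of `Y` at `x`: the convex power lies above its tangent line at
the mean `m`, and the functional calculus preserves this pointwise inequality. -/
theorem rpow_inner_le {Y : H →L[ℝ] H} (hY : Y.IsPositive) {p : ℝ} (hp : 1 ≤ p) {x : H}
    (hx : ‖x‖ = 1) : inner ℝ x (Y x) ^ p ≤ inner ℝ x (opPow Y p x) := by
  have h0 := hY.inner_nonneg_right x
  rcases h0.eq_or_lt with h | hm
  · rw [← h, Real.zero_rpow (by positivity)]
    exact (isPositive_opPow hY (by positivity)).inner_nonneg_right x
  set m := inner ℝ x (Y x) with hmdef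
  -- The affine function is the tangent to `t ^ p` at `m`; after rescaling by `m` the bound is
  -- Bernoulli's inequality.
  have h1 := inner_cfc_le_inner_cfc (Y := Y)
    (f := fun t => m ^ p * (1 - p) + (m ^ p * p / m) * t) (g := fun t => t ^ p)
    (by fun_prop) (Real.continuous_rpow_const (by positivity)) (fun t ht => ?_) x
  · rw [inner_cfc_affine hY.isSelfAdjoint _ _ hx, ← hmdef] at h1
    refine le_trans (le_of_eq ?_) h1
    field_simp
    ring
  · have ht0 := spectrum_nonneg hY ht
    rw [tangent_mul hm ht0]
    have hb := one_add_mul_self_le_rpow_one_add (s := t / m - 1)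
      (by linarith [div_nonneg ht0 hm.le]) hp
    refine le_trans (le_of_eq ?_) (mul_le_mul_of_nonneg_left hb (by positivity))
    field_simp
    ring

theorem inner_opPow_le {Y : H →L[ℝ] H} (hY : Y.IsPositive) {p : ℝ} (hp0 : 0 < p) (hp : p ≤ 1)
    {x : H} (hx : ‖x‖ = 1) : inner ℝ x (opPow Y p x) ≤ inner ℝ x (Y x) ^ p := by
  have h0 := hY.inner_nonneg_right x
  rcases h0.eq_or_lt with h | hm
  · have h1 : Y x = (0 : ℝ) • x := by
      rw [zero_smul]; exact apply_eq_zero_of_inner_eq_zero hY h.symm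
    rw [← h, opPow_apply_eigenvector hY.isSelfAdjoint hp0.le h1, Real.zero_rpow hp0.ne']
    simp
  set m := inner ℝ x (Y x) with hmdef
  have h1 := inner_cfc_le_inner_cfc (Y := Y)
    (g := fun t => m ^ p * (1 - p) + (m ^ p * p / m) * t) (f := fun t => t ^ p)
    (Real.continuous_rpow_const hp0.le) (by fun_prop) (fun t ht => ?_) x
  · rw [inner_cfc_affine hY.isSelfAdjoint _ _ hx, ← hmdef] at h1
    refine h1.trans (le_of_eq ?_)
    field_simp
    ring
  · have ht0 := spectrum_nonneg hY ht
    rw [tangent_mul hm ht0]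
    have hb := rpow_one_add_le_one_add_mul_self (s := t / m - 1)
      (by linarith [div_nonneg ht0 hm.le]) hp0.le hp
    refine (mul_le_mul_of_nonneg_left hb (by positivity)).trans (le_of_eq ?_)
    field_simp
    ring

/-- `t ^ p` need not be operator monotone, but its trace is monotone: Jensen is applied in an
eigenbasis of `X` for `p ≥ 1` and of `Y` for `p ≤ 1`, so that the operator carrying the power inside
the inner product is on the favourable side. -/
theorem opTrace_opPow_mono {X Y : H →L[ℝ] H} (hX : X.IsPositive) (hY : Y.IsPositive)
    (hXc : IsCompactOperator X) (hYc : IsCompactOperator Y)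
    (h : ∀ x, inner ℝ x (X x) ≤ inner ℝ x (Y x)) {p : ℝ} (hp : 0 < p) :
    opTrace (opPow X p) ≤ opTrace (opPow Y p) := by
  rcases le_total 1 p with h1 | h1
  · obtain ⟨ι, b, m, hm⟩ := exists_isDiag hXc hX.isSelfAdjoint
    rw [hm.opTrace_opPow hX hp.le, opTrace_eq_tsum (isPositive_opPow hY hp.le) b]
    refine ENNReal.tsum_le_tsum fun i => ENNReal.ofReal_le_ofReal ?_
    refine le_trans ?_ (rpow_inner_le hY h1 (b.orthonormal.1 i))
    rw [← hm.inner_eq i]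
    exact Real.rpow_le_rpow (hX.inner_nonneg_right _) (h _) hp.le
  · obtain ⟨ι, b, m, hm⟩ := exists_isDiag hYc hY.isSelfAdjoint
    rw [hm.opTrace_opPow hY hp.le, opTrace_eq_tsum (isPositive_opPow hX hp.le) b]
    refine ENNReal.tsum_le_tsum fun i => ENNReal.ofReal_le_ofReal ?_
    refine (inner_opPow_le hX hp h1 (b.orthonormal.1 i)).trans ?_
    rw [← hm.inner_eq i]
    exact Real.rpow_le_rpow (hX.inner_nonneg_right _) (h _) hp.le

/-- `N* N` and `N N*` have the same nonzero eigenvalues with multiplicity. Instead of matching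
eigenvectors, both traces are written as sums of `⟨c j, N (b i)⟩²` with weight eigenvalue to the `p
- 1`; the two weights agree wherever the entry is nonzero. -/
theorem opTrace_opPow_adjoint_comp_self {N : H →L[ℝ] H} (hN : IsCompactOperator N) {p : ℝ}
    (hp : 0 < p) (hN' : IsCompactOperator N.adjoint) :
    opTrace (opPow (N.adjoint ∘L N) p) = opTrace (opPow (N ∘L N.adjoint) p) := by
  have hX := ContinuousLinearMap.isPositive_adjoint_comp_self N
  have hY := ContinuousLinearMap.isPositive_self_comp_adjoint N
  obtain ⟨ι, b, m, hm⟩ := exists_isDiag (hN.clm_comp N.adjoint) hX.isSelfAdjoint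
  obtain ⟨κ, c, n, hn⟩ := exists_isDiag (hN'.clm_comp N) hY.isSelfAdjoint
  rw [hm.opTrace_opPow hX hp.le, hn.opTrace_opPow hY hp.le]
  have hm0 := hm.nonneg hX
  have hn0 := hn.nonneg hY
  have hrow (i : ι) : m i = ‖N (b i)‖ ^ 2 := by
    rw [← hm.inner_eq i, ← real_inner_self_eq_norm_sq]
    exact N.adjoint_inner_right _ _
  have hcol (j : κ) : n j = ‖N.adjoint (c j)‖ ^ 2 := by
    rw [← hn.inner_eq j, ← real_inner_self_eq_norm_sq]
    exact (N.adjoint_inner_left _ _).symm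
  have hw (i : ι) (j : κ) : inner ℝ (c j) (N (b i)) ≠ 0 → m i = n j := by
    intro h0
    have h1 := hn.inner_apply (N (b i)) j
    have h2 : (N ∘L N.adjoint) (N (b i)) = N (m i • b i) := congrArg N (hm i)
    rw [h2, map_smul, inner_smul_right] at h1
    exact mul_right_cancel₀ h0 h1
  have hpow (a : ℝ) (ha : 0 ≤ a) : a ^ p = if a = 0 then 0 else a ^ (p - 1) * a := by
    split_ifs with h0
    · rw [h0, Real.zero_rpow hp.ne']
    · rw [← Real.rpow_add_one h0, sub_add_cancel]
  -- The weight is cut off at zero because `p - 1` may be nonpositive.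
  set g : ℝ → ℝ≥0∞ := fun a => ENNReal.ofReal (if a = 0 then 0 else a ^ (p - 1)) with hg
  have hgpow (a : ℝ) (ha : 0 ≤ a) : ENNReal.ofReal (a ^ p) = g a * ENNReal.ofReal a := by
    rw [hpow a ha, hg, ← ENNReal.ofReal_mul (by split_ifs <;> positivity)]
    congr 1
    split_ifs <;> simp
  calc ∑' i, ENNReal.ofReal (m i ^ p)
      = ∑' i, ∑' j, g (m i) * ENNReal.ofReal (inner ℝ (c j) (N (b i)) ^ 2) := by
        refine tsum_congr fun i => ?_
        rw [hgpow _ (hm0 i), ENNReal.tsum_mul_left, tsum_inner_sq c, hrow]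
    _ = ∑' i, ∑' j, g (n j) * ENNReal.ofReal (inner ℝ (c j) (N (b i)) ^ 2) := by
        refine tsum_congr fun i => tsum_congr fun j => ?_
        by_cases h0 : inner ℝ (c j) (N (b i)) = 0
        · simp [h0]
        · rw [hw i j h0]
    _ = ∑' j, ∑' i, g (n j) * ENNReal.ofReal (inner ℝ (c j) (N (b i)) ^ 2) := ENNReal.tsum_comm
    _ = ∑' j, ENNReal.ofReal (n j ^ p) := by
        refine tsum_congr fun j => ?_
        rw [hgpow _ (hn0 j), ENNReal.tsum_mul_left]
        congr 1
        rw [hcol, ← tsum_inner_sq b]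
        refine tsum_congr fun i => ?_
        rw [ContinuousLinearMap.adjoint_inner_right, real_inner_comm]

theorem isCompactOperator_opPow_half {A : H →L[ℝ] H} (hA : A.IsPositive) {r : ℝ} (hr : 0 < r)
    (h : opTrace (opPow A r) ≠ ⊤) : IsCompactOperator (opPow A (1 / 2)) := by
  refine isCompactOperator_of_opTrace_opPow (isPositive_opPow hA (by norm_num))
    (r := 2 * r) (by positivity) ?_
  rwa [opPow_opPow hA (by norm_num) (by positivity), show 1 / 2 * (2 * r) = r by ring]

/-- With `M = A^(1/2)`, `R A R = (M R)* (M R)` has the same trace of powers as `M R² M`, whose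
quadratic form is `‖R (M x)‖²`. The hypothesis compares these forms, and the trace is monotone. -/
theorem opTrace_opPow_sandwich_le {A S T : H →L[ℝ] H} (hA : A.IsPositive)
    (hAc : IsCompactOperator (opPow A (1 / 2))) (hS : IsSelfAdjoint S) (hT : IsSelfAdjoint T)
    (h : ∀ x, ‖T x‖ ≤ ‖S x‖) {p : ℝ} (hp : 0 < p) :
    opTrace (opPow (T ∘L A ∘L T) p) ≤ opTrace (opPow (S ∘L A ∘L S) p) := by
  set M := opPow A (1 / 2) with hM
  have hMs : M.adjoint = M := (isSelfAdjoint_opPow A _).adjoint_eq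
  have hMM : M ∘L M = A := by rw [hM, opPow_half_mul_self hA one_pos, opPow_one hA]
  have key (R : H →L[ℝ] H) (hR : IsSelfAdjoint R) :
      opTrace (opPow (R ∘L A ∘L R) p) = opTrace (opPow ((M ∘L R) ∘L (M ∘L R).adjoint) p) := by
    have hadj : (M ∘L R).adjoint = R ∘L M := by
      rw [ContinuousLinearMap.adjoint_comp, hR.adjoint_eq, hMs]
    rw [← opTrace_opPow_adjoint_comp_self (hAc.comp_clm R) hp (by
      rw [hadj]; exact hAc.clm_comp R), hadj, ← hMM]
    rfl
  have hcomp (R : H →L[ℝ] H) : IsCompactOperator ((M ∘L R) ∘L (M ∘L R).adjoint) :=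
    (hAc.comp_clm R).comp_clm _
  rw [key T hT, key S hS]
  refine opTrace_opPow_mono (ContinuousLinearMap.isPositive_self_comp_adjoint _)
    (ContinuousLinearMap.isPositive_self_comp_adjoint _) (hcomp _) (hcomp _) (fun x => ?_) hp
  have hval (R : H →L[ℝ] H) (hR : IsSelfAdjoint R) :
      inner ℝ x (((M ∘L R) ∘L (M ∘L R).adjoint) x) = ‖R (M x)‖ ^ 2 := by
    rw [ContinuousLinearMap.comp_apply, ← ContinuousLinearMap.adjoint_inner_left,
      real_inner_self_eq_norm_sq, ContinuousLinearMap.adjoint_comp, hR.adjoint_eq, hMs]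
    rfl
  rw [hval T hT, hval S hS]
  exact pow_le_pow_left₀ (norm_nonneg _) (h _) 2

end

open scoped TensorProduct

/-! ### Operators on a completed tensor product -/

section

variable {H : Type*} [NormedAddCommGroup H] [InnerProductSpace ℝ H] [CompleteSpace H]

/-- On finite combinations of basis vectors the prescribed map is a contraction, so it extends to
`H`. It supplies the quotient of two diagonal operators when the denominator is not invertible. -/
theorem exists_isDiag_of_abs_le_one {ι : Type*} (b : HilbertBasis ι ℝ H) (k : ι → ℝ)
    (hk : ∀ i, |k i| ≤ 1) : ∃ K : H →L[ℝ] H, IsDiag K b k := by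
  let e := Finsupp.linearCombination ℝ (b : ι → H)
  let g := Finsupp.linearCombination ℝ (fun i => k i • b i)
  have he : DenseRange e := by
    have h := b.dense_span
    rw [← Finsupp.range_linearCombination] at h
    exact (Submodule.dense_iff_topologicalClosure_eq_top.2 h : Dense _)
  have hei (l : ι →₀ ℝ) (i : ι) : inner ℝ (b i) (e l) = l i := by
    classical
    simp [e, b.orthonormal.inner_right_finsupp]
  have hgi (l : ι →₀ ℝ) (i : ι) : inner ℝ (b i) (g l) = k i * l i := by
    classical
    simp only [g, Finsupp.linearCombination_apply, Finsupp.sum, inner_sum, inner_smul_right,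
      orthonormal_iff_ite.1 b.orthonormal]
    simp only [mul_ite, mul_one, mul_zero, Finset.sum_ite_eq, Finsupp.mem_support_iff]
    split_ifs with h
    · ring
    · simp [not_not.1 h]
  have hb (l : ι →₀ ℝ) : ‖g l‖ ≤ 1 * ‖e l‖ := by
    rw [one_mul, ← sq_le_sq₀ (norm_nonneg _) (norm_nonneg _),
      ← ENNReal.ofReal_le_ofReal_iff (sq_nonneg _), ← tsum_inner_sq b, ← tsum_inner_sq b]
    refine ENNReal.tsum_le_tsum fun i => ENNReal.ofReal_le_ofReal ?_
    rw [hei, hgi, mul_pow]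
    exact mul_le_of_le_one_left (sq_nonneg _) ((sq_le_one_iff_abs_le_one _).2 (hk i))
  refine ⟨g.extendOfNorm e, fun i => ?_⟩
  have := LinearMap.extendOfNorm_eq he ⟨1, hb⟩ (Finsupp.single i 1)
  simpa [e, g] using this

end

section

variable {H₁ H₂ H : Type*} [NormedAddCommGroup H₁] [InnerProductSpace ℝ H₁] [CompleteSpace H₁]
  [NormedAddCommGroup H₂] [InnerProductSpace ℝ H₂] [CompleteSpace H₂]
  [NormedAddCommGroup H] [InnerProductSpace ℝ H] [CompleteSpace H]
  {J : H₁ ⊗[ℝ] H₂ →ₗᵢ[ℝ] H}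

/-- The tensor product of bounded operators, acting on a Hilbert space `H` which is a completion
of `H₁ ⊗ H₂` by means of `J`. -/
noncomputable def opTensor (J : H₁ ⊗[ℝ] H₂ →ₗᵢ[ℝ] H) (S : H₁ →L[ℝ] H₁) (T : H₂ →L[ℝ] H₂) :
    H →L[ℝ] H :=
  (J.toLinearMap ∘ₗ (TensorProduct.mapL S T).toLinearMap).extendOfNorm J.toLinearMap

theorem opTensor_apply (hJ : DenseRange J) (S : H₁ →L[ℝ] H₁) (T : H₂ →L[ℝ] H₂) (x : H₁) (y : H₂) :
    opTensor J S T (J (x ⊗ₜ y)) = J (S x ⊗ₜ T y) := by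
  refine (LinearMap.extendOfNorm_eq (e := J.toLinearMap) hJ
    ⟨‖TensorProduct.mapL S T‖, fun z => ?_⟩ (x ⊗ₜ y)).trans rfl
  change ‖J _‖ ≤ _ * ‖J _‖
  rw [J.norm_map, J.norm_map]
  exact (TensorProduct.mapL S T).le_opNorm z

theorem clm_ext_tmul (hJ : DenseRange J) {S T : H →L[ℝ] H}
    (h : ∀ x y, S (J (x ⊗ₜ y)) = T (J (x ⊗ₜ y))) : S = T := by
  ext z
  refine hJ.induction_on z (isClosed_eq (by fun_prop) (by fun_prop)) fun t => ?_
  induction t with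
  | zero => simp
  | tmul x y => exact h x y
  | add s t hs ht => rw [map_add, map_add, map_add, hs, ht]

theorem vec_ext_tmul (hJ : DenseRange J) {u v : H}
    (h : ∀ x y, inner ℝ (J (x ⊗ₜ y)) u = inner ℝ (J (x ⊗ₜ y)) v) : u = v := by
  refine ext_inner_left ℝ fun z => ?_
  refine hJ.induction_on z (isClosed_eq (by fun_prop) (by fun_prop)) fun t => ?_
  induction t with
  | zero => simp
  | tmul x y => exact h x y
  | add s t hs ht => rw [map_add, inner_add_left, inner_add_left, hs, ht]

theorem inner_tmul (x x' : H₁) (y y' : H₂) :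
    inner ℝ (J (x ⊗ₜ y)) (J (x' ⊗ₜ y')) = inner ℝ x x' * inner ℝ y y' := by
  rw [J.inner_map_map, TensorProduct.inner_tmul]

theorem opTensor_comp (hJ : DenseRange J) (S S' : H₁ →L[ℝ] H₁) (T T' : H₂ →L[ℝ] H₂) :
    opTensor J S T ∘L opTensor J S' T' = opTensor J (S ∘L S') (T ∘L T') :=
  clm_ext_tmul hJ fun x y => by
    rw [ContinuousLinearMap.comp_apply, opTensor_apply hJ, opTensor_apply hJ, opTensor_apply hJ]
    rfl

theorem isSelfAdjoint_opTensor (hJ : DenseRange J) {S : H₁ →L[ℝ] H₁} {T : H₂ →L[ℝ] H₂}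
    (hS : IsSelfAdjoint S) (hT : IsSelfAdjoint T) : IsSelfAdjoint (opTensor J S T) := by
  rw [ContinuousLinearMap.isSelfAdjoint_iff']
  refine clm_ext_tmul hJ fun x y => vec_ext_tmul hJ fun x' y' => ?_
  rw [ContinuousLinearMap.adjoint_inner_right, opTensor_apply hJ, opTensor_apply hJ, inner_tmul,
    inner_tmul, hS.isSymmetric.apply_clm, hT.isSymmetric.apply_clm]

theorem isPositive_opTensor (hJ : DenseRange J) {S : H₁ →L[ℝ] H₁} {T : H₂ →L[ℝ] H₂}
    (hS : S.IsPositive) (hT : T.IsPositive) : (opTensor J S T).IsPositive := by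
  have h := ContinuousLinearMap.isPositive_adjoint_comp_self
    (opTensor J (opPow S (1 / 2)) (opPow T (1 / 2)))
  rwa [(isSelfAdjoint_opTensor hJ (isSelfAdjoint_opPow S _) (isSelfAdjoint_opPow T _)).adjoint_eq,
    opTensor_comp hJ, opPow_half_mul_self hS one_pos, opPow_half_mul_self hT one_pos,
    opPow_one hS, opPow_one hT] at h

theorem exists_hilbertBasis_tmul (hJ : DenseRange J) {ι κ : Type*} (b : HilbertBasis ι ℝ H₁)
    (c : HilbertBasis κ ℝ H₂) :
    ∃ d : HilbertBasis (ι × κ) ℝ H, ∀ p, d p = J (b p.1 ⊗ₜ c p.2) := by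
  have ho : Orthonormal ℝ fun p : ι × κ => J (b p.1 ⊗ₜ c p.2) := by
    classical
    rw [orthonormal_iff_ite]
    rintro ⟨i, j⟩ ⟨i', j'⟩
    rw [inner_tmul, orthonormal_iff_ite.1 b.orthonormal, orthonormal_iff_ite.1 c.orthonormal]
    simp only [Prod.mk.injEq]
    split_ifs <;> simp_all
  refine ⟨HilbertBasis.mkOfOrthogonalEqBot ho ?_, fun p => by
    rw [HilbertBasis.coe_mkOfOrthogonalEqBot]⟩
  rw [eq_bot_iff]
  intro u hu
  have h0 (i : ι) (j : κ) : inner ℝ u (J (b i ⊗ₜ c j)) = 0 := by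
    rw [real_inner_comm]
    exact (Submodule.mem_orthogonal _ _).1 hu _ (Submodule.subset_span ⟨(i, j), rfl⟩)
  -- Totality: the continuous bilinear form defined by `u` vanishes on pairs of basis vectors, hence
  -- everywhere, by expanding one argument at a time.
  let β : H₁ →L[ℝ] H₂ →L[ℝ] ℝ :=
    ((ContinuousLinearMap.compL ℝ H₂ (H₁ ⊗[ℝ] H₂) ℝ
      (innerSL ℝ u ∘L J.toContinuousLinearMap)) ∘L TensorProduct.mkL ℝ H₁ H₂)
  have hβ (x : H₁) (y : H₂) : β x y = inner ℝ u (J (x ⊗ₜ y)) := rfl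
  have h1 (x : H₁) (j : κ) : β x (c j) = 0 := by
    have hs := ((b.hasSum_repr x).mapL β).mapL (ContinuousLinearMap.apply ℝ ℝ (c j))
    have hz (i : ι) : ContinuousLinearMap.apply ℝ ℝ (c j) (β (b.repr x i • b i)) = 0 := by
      rw [map_smul, map_smul, ContinuousLinearMap.apply_apply, hβ, h0, smul_zero]
    simp only [hz] at hs
    exact hs.unique hasSum_zero
  have h2 (x : H₁) (y : H₂) : β x y = 0 := by
    have hs := (c.hasSum_repr y).mapL (β x)
    simp only [map_smul, h1, smul_zero] at hs
    exact hs.unique hasSum_zero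
  refine (Submodule.mem_bot ℝ).2 (vec_ext_tmul hJ fun x y => ?_)
  rw [inner_zero_right, real_inner_comm, ← hβ, h2]

theorem IsDiag.opTensor (hJ : DenseRange J) {ι κ : Type*} {S : H₁ →L[ℝ] H₁} {T : H₂ →L[ℝ] H₂}
    {b : HilbertBasis ι ℝ H₁} {c : HilbertBasis κ ℝ H₂} {m : ι → ℝ} {n : κ → ℝ}
    (hS : IsDiag S b m) (hT : IsDiag T c n) {d : HilbertBasis (ι × κ) ℝ H}
    (hd : ∀ p, d p = J (b p.1 ⊗ₜ c p.2)) : IsDiag (opTensor J S T) d fun p => m p.1 * n p.2 := by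
  intro p
  rw [hd, opTensor_apply hJ, hS, hT, TensorProduct.smul_tmul_smul, map_smul]

theorem opTrace_opPow_opTensor (hJ : DenseRange J) {S : H₁ →L[ℝ] H₁} {T : H₂ →L[ℝ] H₂}
    (hS : S.IsPositive) (hT : T.IsPositive) (hSc : IsCompactOperator S) (hTc : IsCompactOperator T)
    {p : ℝ} (hp : 0 < p) :
    opTrace (opPow (opTensor J S T) p) = opTrace (opPow S p) * opTrace (opPow T p) := by
  obtain ⟨ι, b, m, hm⟩ := exists_isDiag hSc hS.isSelfAdjoint
  obtain ⟨κ, c, n, hn⟩ := exists_isDiag hTc hT.isSelfAdjoint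
  obtain ⟨d, hd⟩ := exists_hilbertBasis_tmul hJ b c
  rw [(hm.opTensor hJ hn hd).opTrace_opPow (isPositive_opTensor hJ hS hT) hp.le,
    hm.opTrace_opPow hS hp.le, hn.opTrace_opPow hT hp.le, ENNReal.tsum_prod',
    ← ENNReal.tsum_mul_right]
  refine tsum_congr fun i => ?_
  rw [← ENNReal.tsum_mul_left]
  refine tsum_congr fun j => ?_
  have hi := hm.nonneg hS i
  have hj := hn.nonneg hT j
  rw [Real.mul_rpow hi hj, ENNReal.ofReal_mul (by positivity)]

end

/-! ### Bounds on the sandwiched trace -/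

section

variable {H : Type*} [NormedAddCommGroup H] [InnerProductSpace ℝ H] [CompleteSpace H]

theorem isDiag_id {ι : Type*} (b : HilbertBasis ι ℝ H) :
    IsDiag (ContinuousLinearMap.id ℝ H) b fun _ => 1 := fun _ => (one_smul ℝ _).symm

theorem le_sandwichedTrace_of_isDiag {α : ℝ} (h0 : 0 < α) (h1 : α < 1) {A C T : H →L[ℝ] H}
    (hA : A.IsPositive) (hAc : IsCompactOperator (opPow A (1 / 2))) {ι : Type*}
    {b : HilbertBasis ι ℝ H} {c t : ι → ℝ} (hC : IsDiag C b c) (hT : IsDiag T b t)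
    (h : ∀ i, |t i| ≤ c i ^ ((1 - α) / (2 * α))) :
    opTrace (opPow (T ∘L A ∘L T) α) ≤ sandwichedTrace α A C := by
  have hs : 0 ≤ (1 - α) / (2 * α) := div_nonneg (by linarith) (by linarith)
  rw [sandwichedTrace, if_pos h1]
  exact opTrace_opPow_sandwich_le hA hAc (isSelfAdjoint_opPow _ _) hT.isSelfAdjoint
    (hT.norm_apply_le (hC.opPow hC.isSelfAdjoint hs) fun i => (h i).trans (le_abs_self _)) h0

/-- The diagonal quotient `K` of `T` by `C^((α-1)/(2α))` is a contraction, so `K τ K` is a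
competitor in the infimum for `C` whose trace is no larger than that of `τ`. -/
theorem sandwichedTrace_le_of_isDiag {α : ℝ} (h1 : 1 < α) {A C T τ : H →L[ℝ] H}
    (hτ : τ.IsPositive) {ι : Type*} {b : HilbertBasis ι ℝ H} {c t : ι → ℝ} (hC : IsDiag C b c)
    (hT : IsDiag T b t) (ht : ∀ i, |t i| ≤ c i ^ ((α - 1) / (2 * α))) (hTA : T ∘L τ ∘L T = A) :
    sandwichedTrace α A C ≤ opTrace (opPow τ α) := by
  have h0 : 0 < α := by linarith
  have hs : 0 < (α - 1) / (2 * α) := div_pos (by linarith) (by linarith)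
  by_cases hfin : opTrace (opPow τ α) = ⊤
  · rw [hfin]; exact le_top
  set β := (α - 1) / (2 * α) with hβ
  -- Where `c i = 0` the quotient is `0` by convention; this also makes `K` vanish on the kernel of
  -- `C`.
  have hk (i : ι) : |t i / c i ^ β| ≤ 1 := by
    rw [abs_div]
    exact div_le_one_of_le₀ ((ht i).trans (le_abs_self _)) (abs_nonneg _)
  obtain ⟨K, hK⟩ := exists_isDiag_of_abs_le_one b _ hk
  have hS := hC.opPow hC.isSelfAdjoint hs.le
  have hzero (i : ι) (hi : c i ^ β = 0) : t i = 0 :=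
    abs_eq_zero.1 (le_antisymm (hi ▸ ht i) (abs_nonneg _))
  have hdiv (i : ι) : t i / c i ^ β * c i ^ β = t i := by
    by_cases hi : c i ^ β = 0
    · rw [hi, hzero i hi, mul_zero]
    · rw [div_mul_cancel₀ _ hi]
  have hSK : opPow C β ∘L K = T := hilbertBasis_ext_clm b fun i => by
    rw [ContinuousLinearMap.comp_apply, hK i, map_smul, hS i, hT i, smul_smul]
    exact congrArg (· • b i) (hdiv i)
  have hKS : K ∘L opPow C β = T := hilbertBasis_ext_clm b fun i => by
    rw [ContinuousLinearMap.comp_apply, hS i, map_smul, hK i, hT i, smul_smul]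
    exact congrArg (· • b i) ((mul_comm _ _).trans (hdiv i))
  rw [sandwichedTrace, if_neg (by linarith)]
  refine (iInf₂_le (K ∘L τ ∘L K)
    ⟨isPositive_sandwich hτ hK.isSelfAdjoint, fun x hx => ?_, ?_⟩).trans ?_
  · have hid := isDiag_id b
    exact opTrace_opPow_sandwich_le hτ (isCompactOperator_opPow_half hτ h0 hfin)
      hid.isSelfAdjoint hK.isSelfAdjoint
      (hK.norm_apply_le hid fun i => by simpa using hk i) h0
  · have : K x = 0 := hilbertBasis_ext b fun i => by
      rw [hK.inner_apply, inner_zero_right]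
      have h2 := hC.inner_apply x i
      rw [hx, inner_zero_right] at h2
      rcases mul_eq_zero.1 h2.symm with h3 | h3
      · rw [h3, Real.zero_rpow hs.ne', div_zero, zero_mul]
      · rw [h3, mul_zero]
    rw [ContinuousLinearMap.comp_apply, ContinuousLinearMap.comp_apply, this, map_zero, map_zero]
  · calc opPow C β ∘L (K ∘L τ ∘L K) ∘L opPow C β
        = (opPow C β ∘L K) ∘L τ ∘L (K ∘L opPow C β) := rfl
      _ = A := by rw [hSK, hKS, hTA]

/-- Eigenvalues summing to one lie in `[0, 1]`, where raising the exponent decreases the power. -/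
theorem opTrace_opPow_of_opTrace_eq_one {A : H →L[ℝ] H} (hA : A.IsPositive)
    (h : opTrace A = 1) {p : ℝ} (hp : 0 < p) :
    (p ≤ 1 → 1 ≤ opTrace (opPow A p)) ∧ (1 ≤ p → opTrace (opPow A p) ≤ 1) := by
  have hfin : opTrace (opPow A 1) ≠ ⊤ := by rw [opPow_one hA, h]; simp
  obtain ⟨ι, b, m, hm⟩ := exists_isDiag (isCompactOperator_of_opTrace_opPow hA one_pos hfin)
    hA.isSelfAdjoint
  have hm0 := hm.nonneg hA
  rw [hm.opTrace_opPow hA hp.le]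
  rw [opTrace_eq_tsum hA b] at h
  simp_rw [hm.inner_eq] at h
  have hm1 (i : ι) : m i ≤ 1 := by
    have := ENNReal.le_tsum (f := fun i => ENNReal.ofReal (m i)) i
    rw [h] at this
    exact ENNReal.ofReal_le_one.1 this
  rw [← h]
  refine ⟨fun hp1 => ?_, fun hp1 => ?_⟩
  · refine ENNReal.tsum_le_tsum fun i => ENNReal.ofReal_le_ofReal ?_
    simpa using Real.rpow_le_rpow_of_exponent_ge' (hm0 i) (hm1 i) hp.le hp1
  · refine ENNReal.tsum_le_tsum fun i => ENNReal.ofReal_le_ofReal ?_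
    simpa using Real.rpow_le_rpow_of_exponent_ge' (hm0 i) (hm1 i) zero_le_one hp1

theorem isCompactOperator_of_opTrace_eq_one {A : H →L[ℝ] H} (hA : A.IsPositive)
    (h : opTrace A = 1) : IsCompactOperator A :=
  isCompactOperator_of_opTrace_opPow hA one_pos (by rw [opPow_one hA, h]; simp)

theorem isCompactOperator_opPow_half_of_opTrace_eq_one {A : H →L[ℝ] H} (hA : A.IsPositive)
    (h : opTrace A = 1) : IsCompactOperator (opPow A (1 / 2)) :=
  isCompactOperator_opPow_half hA one_pos (by rw [opPow_one hA, h]; simp)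

universe u in
theorem exists_isDiag_of_opTrace_eq_one {H : Type u} [NormedAddCommGroup H] [InnerProductSpace ℝ H]
    [CompleteSpace H] {B : H →L[ℝ] H} (hB : B.IsPositive) (h : opTrace B = 1) :
    ∃ (ι : Type u) (b : HilbertBasis ι ℝ H) (m : ι → ℝ), IsDiag B b m ∧ ∀ i, m i ∈ Set.Icc 0 1 := by
  obtain ⟨ι, b, m, hm⟩ := exists_isDiag (isCompactOperator_of_opTrace_eq_one hB h) hB.isSelfAdjoint
  refine ⟨ι, b, m, hm, fun i => ⟨hm.nonneg hB i, ?_⟩⟩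
  have := ENNReal.le_tsum (f := fun i => ENNReal.ofReal (inner ℝ (b i) (B (b i)))) i
  rw [← opTrace_eq_tsum hB b, h, hm.inner_eq] at this
  exact ENNReal.ofReal_le_one.1 this

theorem IsDiag.add_smul_id {ι : Type*} {T : H →L[ℝ] H} {b : HilbertBasis ι ℝ H} {m : ι → ℝ}
    (h : IsDiag T b m) (l : ℝ) :
    IsDiag (T + l • ContinuousLinearMap.id ℝ H) b fun i => m i + l := fun i => by
  rw [add_apply, h i, add_smul]
  rfl

/-- Since `B + l ≥ Id`, replacing the sandwiching power by the identity only lowers the trace.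
Together with `sandwichedTrace_le_one`, this handles large regularization. -/
theorem one_le_sandwichedTrace {α : ℝ} (h0 : 0 < α) (h1 : α < 1) {A B : H →L[ℝ] H}
    (hA : A.IsPositive) (hB : B.IsPositive) (hA1 : opTrace A = 1) (hB1 : opTrace B = 1) {l : ℝ}
    (hl : 1 ≤ l) : 1 ≤ sandwichedTrace α A (B + l • ContinuousLinearMap.id ℝ H) := by
  obtain ⟨ι, b, m, hm, hmI⟩ := exists_isDiag_of_opTrace_eq_one hB hB1
  refine ((opTrace_opPow_of_opTrace_eq_one hA hA1 h0).1 h1.le).trans ?_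
  refine le_sandwichedTrace_of_isDiag h0 h1 hA (isCompactOperator_opPow_half_of_opTrace_eq_one hA hA1)
    (hm.add_smul_id l) (isDiag_id b) fun i => ?_
  rw [abs_one]
  exact Real.one_le_rpow (by linarith [(hmI i).1]) (div_nonneg (by linarith) (by linarith))

theorem sandwichedTrace_le_one {α : ℝ} (h1 : 1 < α) {A B : H →L[ℝ] H}
    (hA : A.IsPositive) (hB : B.IsPositive) (hA1 : opTrace A = 1) (hB1 : opTrace B = 1) {l : ℝ}
    (hl : 1 ≤ l) : sandwichedTrace α A (B + l • ContinuousLinearMap.id ℝ H) ≤ 1 := by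
  obtain ⟨ι, b, m, hm, hmI⟩ := exists_isDiag_of_opTrace_eq_one hB hB1
  refine le_trans ?_ ((opTrace_opPow_of_opTrace_eq_one hA hA1 (by linarith)).2 h1.le)
  refine sandwichedTrace_le_of_isDiag h1 hA (hm.add_smul_id l) (isDiag_id b) (fun i => ?_) rfl
  rw [abs_one]
  exact Real.one_le_rpow (by linarith [(hmI i).1]) (div_nonneg (by linarith) (by linarith))

theorem EReal_inv_mul_le_iff_of_pos {c ε : ℝ} (hc : 0 < c) (x : EReal) :
    (c⁻¹ : ℝ) * x ≤ (ε : EReal) ↔ x ≤ ((c * ε : ℝ) : EReal) := by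
  induction x with
  | bot => simp [EReal.coe_mul_bot_of_pos (inv_pos.2 hc)]
  | top =>
    rw [EReal.coe_mul_top_of_pos (inv_pos.2 hc)]
    simp only [top_le_iff, EReal.coe_ne_top]
  | coe x => rw [← EReal.coe_mul, EReal.coe_le_coe_iff, EReal.coe_le_coe_iff, inv_mul_le_iff₀ hc]

theorem EReal_inv_mul_le_iff_of_neg {c ε : ℝ} (hc : c < 0) (x : EReal) :
    (c⁻¹ : ℝ) * x ≤ (ε : EReal) ↔ ((c * ε : ℝ) : EReal) ≤ x := by
  induction x with
  | bot =>
    rw [EReal.coe_mul_bot_of_neg (inv_neg''.2 hc)]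
    simp only [top_le_iff, le_bot_iff, EReal.coe_ne_top, EReal.coe_ne_bot]
  | top => simp [EReal.coe_mul_top_of_neg (inv_neg''.2 hc)]
  | coe x =>
    rw [← EReal.coe_mul, EReal.coe_le_coe_iff, EReal.coe_le_coe_iff, mul_comm, ← div_eq_mul_inv,
      div_le_iff_of_neg hc, mul_comm]

theorem quantumRenyi_le_iff_of_lt_one {α ε : ℝ} (h1 : α < 1) {A B : H →L[ℝ] H}
    (hA : opTrace A = 1) : quantumRenyi α A B ≤ ε ↔
      ENNReal.ofReal (Real.exp ((α - 1) * ε)) ≤ sandwichedTrace α A B := by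
  rw [quantumRenyi, hA, div_one, EReal_inv_mul_le_iff_of_neg (by linarith), ← ENNReal.log_le_log_iff,
    ENNReal.log_ofReal_of_pos (Real.exp_pos _), Real.log_exp]

theorem quantumRenyi_le_iff_of_one_lt {α ε : ℝ} (h1 : 1 < α) {A B : H →L[ℝ] H}
    (hA : opTrace A = 1) : quantumRenyi α A B ≤ ε ↔
      sandwichedTrace α A B ≤ ENNReal.ofReal (Real.exp ((α - 1) * ε)) := by
  rw [quantumRenyi, hA, div_one, EReal_inv_mul_le_iff_of_pos (by linarith), ← ENNReal.log_le_log_iff,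
    ENNReal.log_ofReal_of_pos (Real.exp_pos _), Real.log_exp]

end

/-! ### Subadditivity under tensor products -/

section

variable {H₁ H₂ H : Type*} [NormedAddCommGroup H₁] [InnerProductSpace ℝ H₁] [CompleteSpace H₁]
  [NormedAddCommGroup H₂] [InnerProductSpace ℝ H₂] [CompleteSpace H₂]
  [NormedAddCommGroup H] [InnerProductSpace ℝ H] [CompleteSpace H]
  {J : H₁ ⊗[ℝ] H₂ →ₗᵢ[ℝ] H}

theorem abs_rpow_mul_rpow_le {x y l r : ℝ} (hx : x ∈ Set.Icc 0 1) (hy : y ∈ Set.Icc 0 1)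
    (hl : 0 ≤ l) (hl3 : l ≤ 3) (hr : 0 ≤ r) :
    |(x + l / 3) ^ r * (y + l / 3) ^ r| ≤ (x * y + l) ^ r := by
  obtain ⟨hx0, hx1⟩ := hx
  obtain ⟨hy0, hy1⟩ := hy
  rw [← Real.mul_rpow (by positivity) (by positivity), abs_of_nonneg (by positivity)]
  refine Real.rpow_le_rpow (by positivity) ?_ hr
  -- The excess over `x * y` is `(l/3) (x + y) + l²/9`, at most `2l/3 + l/3`: this is where `l/3`
  -- and `l ≤ 3` come from.
  nlinarith [mul_nonneg hl (sub_nonneg.2 hx1), mul_nonneg hl (sub_nonneg.2 hy1),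
    mul_nonneg hl (sub_nonneg.2 hl3)]

theorem sandwichedTrace_mul_le_opTensor (hJ : DenseRange J) {α : ℝ} (h0 : 0 < α) (h1 : α < 1)
    {A₁ B₁ : H₁ →L[ℝ] H₁} {A₂ B₂ : H₂ →L[ℝ] H₂} (hA₁ : A₁.IsPositive) (hA₂ : A₂.IsPositive)
    (hB₁ : B₁.IsPositive) (hB₂ : B₂.IsPositive) (hA₁t : opTrace A₁ = 1) (hA₂t : opTrace A₂ = 1)
    (hB₁t : opTrace B₁ = 1) (hB₂t : opTrace B₂ = 1) (hAt : opTrace (opTensor J A₁ A₂) = 1)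
    {l : ℝ} (hl : 0 ≤ l) (hl3 : l ≤ 3) :
    sandwichedTrace α A₁ (B₁ + (l / 3) • ContinuousLinearMap.id ℝ H₁) *
        sandwichedTrace α A₂ (B₂ + (l / 3) • ContinuousLinearMap.id ℝ H₂) ≤
      sandwichedTrace α (opTensor J A₁ A₂) (opTensor J B₁ B₂ + l • ContinuousLinearMap.id ℝ H) := by
  have hs : 0 ≤ (1 - α) / (2 * α) := div_nonneg (by linarith) (by linarith)
  obtain ⟨ι, b, m, hm, hmI⟩ := exists_isDiag_of_opTrace_eq_one hB₁ hB₁t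
  obtain ⟨κ, c, n, hn, hnI⟩ := exists_isDiag_of_opTrace_eq_one hB₂ hB₂t
  obtain ⟨d, hd⟩ := exists_hilbertBasis_tmul hJ b c
  have hC₁ := hm.add_smul_id (l / 3)
  have hC₂ := hn.add_smul_id (l / 3)
  have hA := isPositive_opTensor hJ hA₁ hA₂
  have hT := (hC₁.opPow hC₁.isSelfAdjoint hs).opTensor hJ (hC₂.opPow hC₂.isSelfAdjoint hs) hd
  have hC := (hm.opTensor hJ hn hd).add_smul_id l
  refine le_trans (le_of_eq ?_) (le_sandwichedTrace_of_isDiag h0 h1 hA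
    (isCompactOperator_opPow_half_of_opTrace_eq_one hA hAt) hC hT fun p =>
      abs_rpow_mul_rpow_le (hmI p.1) (hnI p.2) hl hl3 hs)
  rw [opTensor_comp hJ, opTensor_comp hJ, opTrace_opPow_opTensor hJ
    (isPositive_sandwich hA₁ (isSelfAdjoint_opPow _ _))
    (isPositive_sandwich hA₂ (isSelfAdjoint_opPow _ _))
    (((isCompactOperator_of_opTrace_eq_one hA₁ hA₁t).comp_clm _).clm_comp _)
    (((isCompactOperator_of_opTrace_eq_one hA₂ hA₂t).comp_clm _).clm_comp _) h0,
    sandwichedTrace, sandwichedTrace, if_pos h1, if_pos h1]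

/-- Finite upper bounds `a₁`, `a₂` stand in for the two traces: they exclude `0 * ∞` and guarantee
that admissible `τ₁`, `τ₂` exist. -/
theorem sandwichedTrace_opTensor_le_mul (hJ : DenseRange J) {α : ℝ} (h1 : 1 < α)
    {A₁ B₁ : H₁ →L[ℝ] H₁} {A₂ B₂ : H₂ →L[ℝ] H₂}
    (hB₁ : B₁.IsPositive) (hB₂ : B₂.IsPositive)
    (hB₁t : opTrace B₁ = 1) (hB₂t : opTrace B₂ = 1) {l : ℝ} (hl : 0 ≤ l) (hl3 : l ≤ 3)
    {a₁ a₂ : ℝ≥0∞} (ha₁ : a₁ ≠ ⊤) (ha₂ : a₂ ≠ ⊤)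
    (h₁ : sandwichedTrace α A₁ (B₁ + (l / 3) • ContinuousLinearMap.id ℝ H₁) ≤ a₁)
    (h₂ : sandwichedTrace α A₂ (B₂ + (l / 3) • ContinuousLinearMap.id ℝ H₂) ≤ a₂) :
    sandwichedTrace α (opTensor J A₁ A₂) (opTensor J B₁ B₂ + l • ContinuousLinearMap.id ℝ H) ≤
      a₁ * a₂ := by
  have h0 : 0 < α := by linarith
  have hs : 0 ≤ (α - 1) / (2 * α) := div_nonneg (by linarith) (by linarith)
  obtain ⟨ι, b, m, hm, hmI⟩ := exists_isDiag_of_opTrace_eq_one hB₁ hB₁t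
  obtain ⟨κ, c, n, hn, hnI⟩ := exists_isDiag_of_opTrace_eq_one hB₂ hB₂t
  obtain ⟨d, hd⟩ := exists_hilbertBasis_tmul hJ b c
  have hC₁ := hm.add_smul_id (l / 3)
  have hC₂ := hn.add_smul_id (l / 3)
  have hT := (hC₁.opPow hC₁.isSelfAdjoint hs).opTensor hJ (hC₂.opPow hC₂.isSelfAdjoint hs) hd
  have hC := (hm.opTensor hJ hn hd).add_smul_id l
  -- The traces are infima, so near-optimal `τ₁`, `τ₂` are taken with traces below slightly larger
  -- bounds.
  refine ENNReal.le_mul_of_forall_lt (Or.inr ha₂) (Or.inl ha₁) fun a₁' ha₁' a₂' ha₂' => ?_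
  replace h₁ := h₁.trans_lt ha₁'
  replace h₂ := h₂.trans_lt ha₂'
  rw [sandwichedTrace, if_neg (by linarith)] at h₁ h₂
  simp only [iInf_lt_iff] at h₁ h₂
  obtain ⟨τ₁, ⟨hτ₁, -, hτA₁⟩, hlt₁⟩ := h₁
  obtain ⟨τ₂, ⟨hτ₂, -, hτA₂⟩, hlt₂⟩ := h₂
  refine (sandwichedTrace_le_of_isDiag h1 (isPositive_opTensor hJ hτ₁ hτ₂) hC hT (fun p =>
    abs_rpow_mul_rpow_le (hmI p.1) (hnI p.2) hl hl3 hs) ?_).trans ?_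
  · rw [opTensor_comp hJ, opTensor_comp hJ, hτA₁, hτA₂]
  · rw [opTrace_opPow_opTensor hJ hτ₁ hτ₂
      (isCompactOperator_of_opTrace_opPow hτ₁ h0 hlt₁.ne_top)
      (isCompactOperator_of_opTrace_opPow hτ₂ h0 hlt₂.ne_top) h0]
    exact mul_le_mul' hlt₁.le hlt₂.le

/-- Subadditivity of the regularized divergence under tensor products. -/
theorem regQuantumRenyi_opTensor_le (hJ : DenseRange J) {α : ℝ} (hα : α ∈ Set.Ioo 0 1 ∪ Set.Ioi 1)
    {A₁ B₁ : H₁ →L[ℝ] H₁} {A₂ B₂ : H₂ →L[ℝ] H₂} (hA₁ : A₁.IsPositive) (hA₂ : A₂.IsPositive)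
    (hB₁ : B₁.IsPositive) (hB₂ : B₂.IsPositive) (hA₁t : opTrace A₁ = 1) (hA₂t : opTrace A₂ = 1)
    (hB₁t : opTrace B₁ = 1) (hB₂t : opTrace B₂ = 1) (hAt : opTrace (opTensor J A₁ A₂) = 1)
    (hBt : opTrace (opTensor J B₁ B₂) = 1)
    {l ε₁ ε₂ : ℝ} (hl : 0 ≤ l) (hlε : l ≤ 3 ∨ 0 ≤ ε₁ + ε₂)
    (h₁ : regQuantumRenyi α (l / 3) A₁ B₁ ≤ ε₁) (h₂ : regQuantumRenyi α (l / 3) A₂ B₂ ≤ ε₂) :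
    regQuantumRenyi α l (opTensor J A₁ A₂) (opTensor J B₁ B₂) ≤ ((ε₁ + ε₂ : ℝ) : EReal) := by
  unfold regQuantumRenyi at *
  have hA := isPositive_opTensor hJ hA₁ hA₂
  have hB := isPositive_opTensor hJ hB₁ hB₂
  rcases hα with ⟨h0, h1⟩ | h1
  · rw [quantumRenyi_le_iff_of_lt_one h1 hA₁t] at h₁
    rw [quantumRenyi_le_iff_of_lt_one h1 hA₂t] at h₂
    rw [quantumRenyi_le_iff_of_lt_one h1 hAt]
    by_cases hl3 : l ≤ 3
    · rw [mul_add, Real.exp_add, ENNReal.ofReal_mul (Real.exp_nonneg _)]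
      exact (mul_le_mul' h₁ h₂).trans (sandwichedTrace_mul_le_opTensor hJ h0 h1 hA₁ hA₂ hB₁ hB₂
        hA₁t hA₂t hB₁t hB₂t hAt hl hl3)
    · refine le_trans ?_ (one_le_sandwichedTrace h0 h1 hA hB hAt hBt (by linarith))
      rw [ENNReal.ofReal_le_one, Real.exp_le_one_iff]
      exact mul_nonpos_of_nonpos_of_nonneg (by linarith) (hlε.resolve_left hl3)
  · have h1 : 1 < α := h1
    rw [quantumRenyi_le_iff_of_one_lt h1 hA₁t] at h₁
    rw [quantumRenyi_le_iff_of_one_lt h1 hA₂t] at h₂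
    rw [quantumRenyi_le_iff_of_one_lt h1 hAt]
    by_cases hl3 : l ≤ 3
    · rw [mul_add, Real.exp_add, ENNReal.ofReal_mul (Real.exp_nonneg _)]
      exact sandwichedTrace_opTensor_le_mul hJ h1 hB₁ hB₂ hB₁t hB₂t hl hl3 ENNReal.ofReal_ne_top
        ENNReal.ofReal_ne_top h₁ h₂
    · refine (sandwichedTrace_le_one h1 hA hB hAt hBt (by linarith)).trans ?_
      rw [ENNReal.one_le_ofReal, Real.one_le_exp_iff]
      exact mul_nonneg (by linarith) (hlε.resolve_left hl3)

end

/-- Distinct basis vectors are at distance `√2`, so balls of radius `1/2` around them are disjoint.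
Countability permits exchanging the trace with the integral. -/
theorem countable_of_separable {H : Type*} [NormedAddCommGroup H] [InnerProductSpace ℝ H]
    [TopologicalSpace.SeparableSpace H] {ι : Type*} (b : HilbertBasis ι ℝ H) : Countable ι := by
  refine Pairwise.countable_of_isOpen_disjoint (s := fun i => Metric.ball (b i) (1 / 2))
    (fun i j hij => Metric.ball_disjoint_ball ?_) (fun i => Metric.isOpen_ball)
    fun i => ⟨b i, Metric.mem_ball_self (by norm_num)⟩
  have h : ‖b i - b j‖ ^ 2 = 2 := by
    rw [norm_sub_sq_real, b.orthonormal.1 i, b.orthonormal.1 j, b.orthonormal.2 hij]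
    norm_num
  rw [dist_eq_norm]
  nlinarith [norm_nonneg (b i - b j)]

end HilbertOp

/-! ### Feature maps and covariance operators -/

namespace PDKernel

open MeasureTheory
open scoped TensorProduct

section

variable {X : Type*} [TopologicalSpace X] (k : PDKernel X)

theorem norm_feature (x : X) : ‖k.feature x‖ = 1 := by
  have h := real_inner_self_eq_norm_sq (k.feature x)
  rw [inner_feature_feature, k.diag_eq_one] at h
  exact (pow_eq_one_iff_of_nonneg (norm_nonneg _) two_ne_zero).1 h.symm

theorem continuous_feature : Continuous k.feature := by
  rw [continuous_iff_continuousAt]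
  intro x
  rw [ContinuousAt, tendsto_iff_norm_sub_tendsto_zero]
  have h (y : X) : ‖k.feature y - k.feature x‖ = √(2 - 2 * k.toFun y x) := by
    rw [← Real.sqrt_sq (norm_nonneg _), norm_sub_sq_real, norm_feature, norm_feature,
      inner_feature_feature]
    congr 1
    ring
  have hc : Continuous fun y => √(2 - 2 * k.toFun y x) :=
    (continuous_const.sub (continuous_const.mul
      (k.continuous_toFun.comp (by fun_prop : Continuous fun y : X => (y, x))))).sqrt
  have h0 := hc.tendsto x
  rw [k.diag_eq_one, mul_one, sub_self, Real.sqrt_zero] at h0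
  exact h0.congr fun y => (h y).symm

/-- By the reproducing property, a function orthogonal to every feature vanishes at every point. -/
theorem topologicalClosure_span_feature :
    (Submodule.span ℝ (Set.range k.feature)).topologicalClosure = ⊤ := by
  rw [Submodule.topologicalClosure_eq_top_iff, eq_bot_iff]
  intro h hh
  rw [Submodule.mem_bot]
  refine DFunLike.ext h 0 fun x => ?_
  rw [← inner_feature, real_inner_comm]
  refine ((Submodule.mem_orthogonal _ _).1 hh _ (Submodule.subset_span ⟨x, rfl⟩)).trans ?_
  exact (congrFun (RKHS.coe_zero (H := k.rkhs)) x).symm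

instance separableSpace_rkhs [TopologicalSpace.SeparableSpace X] :
    TopologicalSpace.SeparableSpace k.rkhs := by
  rw [← TopologicalSpace.isSeparable_univ_iff]
  have h := ((TopologicalSpace.isSeparable_range k.continuous_feature).span (R := ℝ)).closure
  have h2 := congrArg (fun S : Submodule ℝ k.rkhs => (S : Set k.rkhs))
    k.topologicalClosure_span_feature
  simp only [Submodule.topologicalClosure_coe, Submodule.top_coe] at h2
  rwa [h2] at h

variable [SecondCountableTopology X] [MeasurableSpace X] [BorelSpace X] (p : Measure X)
  [IsProbabilityMeasure p]

theorem integrable_rankOne_feature :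
    Integrable (fun x => InnerProductSpace.rankOne ℝ (k.feature x) (k.feature x)) p := by
  have hc : Continuous fun x => InnerProductSpace.rankOne ℝ (k.feature x) (k.feature x) :=
    ((InnerProductSpace.rankOne ℝ).continuous.comp k.continuous_feature).clm_apply
      k.continuous_feature
  refine Integrable.of_bound hc.aestronglyMeasurable 1 (Filter.Eventually.of_forall fun x => ?_)
  rw [InnerProductSpace.norm_rankOne, norm_feature, one_mul]

theorem inner_covariance (u v : k.rkhs) :
    inner ℝ u (k.covariance p v) =
      ∫ x, inner ℝ u (k.feature x) * inner ℝ (k.feature x) v ∂p := by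
  have hi := k.integrable_rankOne_feature p
  rw [covariance, ContinuousLinearMap.integral_apply hi,
    ← integral_inner (hi.apply_continuousLinearMap v)]
  refine integral_congr_ae (Filter.Eventually.of_forall fun x => ?_)
  simp only [InnerProductSpace.rankOne_apply, inner_smul_right]
  ring

theorem isPositive_covariance : (k.covariance p).IsPositive := by
  refine HilbertOp.isPositive_of_inner_nonneg ?_ fun u => ?_
  · rw [ContinuousLinearMap.isSelfAdjoint_iff']
    ext1 v
    refine ext_inner_left ℝ fun u => ?_
    rw [ContinuousLinearMap.adjoint_inner_right, real_inner_comm, inner_covariance,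
      inner_covariance]
    refine integral_congr_ae (Filter.Eventually.of_forall fun x => ?_)
    simp only [real_inner_comm]
    ring
  · rw [real_inner_comm, inner_covariance]
    refine integral_nonneg fun x => ?_
    simp only [real_inner_comm u]
    exact mul_self_nonneg _

/-- Tonelli and Parseval reduce the trace to the integral of `‖φ x‖² = 1`. -/
theorem opTrace_covariance : opTrace (k.covariance p) = 1 := by
  obtain ⟨w, b, -⟩ := exists_hilbertBasis ℝ k.rkhs
  have := HilbertOp.countable_of_separable b
  rw [HilbertOp.opTrace_eq_tsum (k.isPositive_covariance p) b]
  have hc (i : w) : Continuous fun x => inner ℝ (b i) (k.feature x) ^ 2 :=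
    (continuous_const.inner k.continuous_feature).pow 2
  have h (i : w) : ENNReal.ofReal (inner ℝ (b i) (k.covariance p (b i))) =
      ∫⁻ x, ENNReal.ofReal (inner ℝ (b i) (k.feature x) ^ 2) ∂p := by
    rw [inner_covariance, ← ofReal_integral_eq_lintegral_ofReal]
    · congr 2 with x
      rw [real_inner_comm (b i), pow_two]
    · refine Integrable.of_bound (hc i).aestronglyMeasurable 1
        (Filter.Eventually.of_forall fun x => ?_)
      have := abs_real_inner_le_norm (b i) (k.feature x)
      rw [b.orthonormal.1 i, norm_feature, one_mul] at this
      rw [Real.norm_of_nonneg (sq_nonneg _)]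
      exact (sq_le_one_iff_abs_le_one _).2 this
    · exact Filter.Eventually.of_forall fun x => sq_nonneg _
  simp_rw [h]
  rw [← lintegral_tsum fun i => (hc i).measurable.ennreal_ofReal.aemeasurable]
  simp_rw [HilbertOp.tsum_inner_sq b, norm_feature]
  simp

end

/-! ### The RKHS and the covariance of a product kernel -/

section

variable {X Y : Type*} [TopologicalSpace X] [TopologicalSpace Y] (k₁ : PDKernel X)
  (k₂ : PDKernel Y)

theorem dense_span_feature_tmul :
    Dense (Submodule.span ℝ (Set.range fun p : X × Y => k₁.feature p.1 ⊗ₜ[ℝ] k₂.feature p.2) :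
      Set (k₁.rkhs ⊗[ℝ] k₂.rkhs)) := by
  rw [Submodule.dense_iff_topologicalClosure_eq_top, eq_top_iff]
  set M := (Submodule.span ℝ
    (Set.range fun p : X × Y => k₁.feature p.1 ⊗ₜ[ℝ] k₂.feature p.2)).topologicalClosure with hM
  have hMc : IsClosed (M : Set (k₁.rkhs ⊗[ℝ] k₂.rkhs)) := Submodule.isClosed_topologicalClosure _
  have h1 (a : k₁.rkhs) (y : Y) : a ⊗ₜ k₂.feature y ∈ M := by
    let L : k₁.rkhs →L[ℝ] k₁.rkhs ⊗[ℝ] k₂.rkhs :=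
      (TensorProduct.mkL ℝ k₁.rkhs k₂.rkhs).flip (k₂.feature y)
    have : (Submodule.span ℝ (Set.range k₁.feature)).topologicalClosure ≤
        M.comap (L : k₁.rkhs →ₗ[ℝ] k₁.rkhs ⊗[ℝ] k₂.rkhs) := by
      refine Submodule.topologicalClosure_minimal _ (Submodule.span_le.2 ?_)
        (hMc.preimage L.continuous)
      rintro _ ⟨x, rfl⟩
      exact Submodule.le_topologicalClosure _ (Submodule.subset_span ⟨(x, y), rfl⟩)
    rw [topologicalClosure_span_feature] at this
    exact this (Submodule.mem_top (x := a))
  have h2 (a : k₁.rkhs) (c : k₂.rkhs) : a ⊗ₜ c ∈ M := by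
    let L : k₂.rkhs →L[ℝ] k₁.rkhs ⊗[ℝ] k₂.rkhs := TensorProduct.mkL ℝ k₁.rkhs k₂.rkhs a
    have : (Submodule.span ℝ (Set.range k₂.feature)).topologicalClosure ≤
        M.comap (L : k₂.rkhs →ₗ[ℝ] k₁.rkhs ⊗[ℝ] k₂.rkhs) := by
      refine Submodule.topologicalClosure_minimal _ (Submodule.span_le.2 ?_)
        (hMc.preimage L.continuous)
      rintro _ ⟨y, rfl⟩
      exact h1 a y
    rw [topologicalClosure_span_feature] at this
    exact this (Submodule.mem_top (x := c))
  intro z _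
  induction z with
  | zero => exact M.zero_mem
  | tmul a c => exact h2 a c
  | add s t hs ht => exact M.add_mem (hs trivial) (ht trivial)

/-- The RKHS of the product kernel is a completion of the tensor product of the RKHSs. -/
theorem exists_tensor_isometry :
    ∃ J : k₁.rkhs ⊗[ℝ] k₂.rkhs →ₗᵢ[ℝ] (k₁.prod k₂).rkhs, DenseRange J ∧
      ∀ x y, J (k₁.feature x ⊗ₜ k₂.feature y) = (k₁.prod k₂).feature (x, y) := by
  let e := Finsupp.linearCombination ℝ
    fun p : X × Y => k₁.feature p.1 ⊗ₜ[ℝ] k₂.feature p.2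
  let g := Finsupp.linearCombination ℝ (k₁.prod k₂).feature
  have he : DenseRange e := by
    have h := dense_span_feature_tmul k₁ k₂
    rw [← Finsupp.range_linearCombination] at h
    exact h
  -- Both families of vectors have the product kernel as Gram matrix, so sending `e l` to `g l` is
  -- well defined and isometric on a dense subspace.
  have hge (l : X × Y →₀ ℝ) : ‖g l‖ = ‖e l‖ := by
    rw [← sq_eq_sq₀ (norm_nonneg _) (norm_nonneg _), ← real_inner_self_eq_norm_sq,
      ← real_inner_self_eq_norm_sq]
    simp only [g, e, Finsupp.linearCombination_apply, Finsupp.sum, sum_inner, inner_sum,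
      inner_smul_left, inner_smul_right, inner_feature_feature, TensorProduct.inner_tmul]
    rfl
  have hJe (l : X × Y →₀ ℝ) : g.extendOfNorm e (e l) = g l :=
    LinearMap.extendOfNorm_eq he ⟨1, fun l => by rw [one_mul, hge]⟩ l
  let J : k₁.rkhs ⊗[ℝ] k₂.rkhs →ₗᵢ[ℝ] (k₁.prod k₂).rkhs :=
    { toLinearMap := (g.extendOfNorm e).toLinearMap
      norm_map' := fun z => by
        refine he.induction_on z (isClosed_eq (g.extendOfNorm e).continuous.norm continuous_norm)
          fun l => ?_
        exact (congrArg norm (hJe l)).trans (hge l) }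
  have hJ (l : X × Y →₀ ℝ) : J (e l) = g l := hJe l
  refine ⟨J, ?_, fun x y => ?_⟩
  · have h : Dense (Submodule.span ℝ (Set.range (k₁.prod k₂).feature) : Set (k₁.prod k₂).rkhs) :=
      Submodule.dense_iff_topologicalClosure_eq_top.2 (k₁.prod k₂).topologicalClosure_span_feature
    rw [← Finsupp.range_linearCombination] at h
    refine h.mono ?_
    rintro _ ⟨l, rfl⟩
    exact ⟨e l, hJ l⟩
  · have := hJ (Finsupp.single (x, y) 1)
    simpa [e, g] using this

variable [SecondCountableTopology X] [MeasurableSpace X] [BorelSpace X]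
  [SecondCountableTopology Y] [MeasurableSpace Y] [BorelSpace Y]

/-- Tested against elementary tensors, the integrand splits into a factor for each coordinate and
Fubini applies. -/
theorem covariance_prod {J : k₁.rkhs ⊗[ℝ] k₂.rkhs →ₗᵢ[ℝ] (k₁.prod k₂).rkhs} (hJ : DenseRange J)
    (hJf : ∀ x y, J (k₁.feature x ⊗ₜ k₂.feature y) = (k₁.prod k₂).feature (x, y))
    (p : Measure X) (q : Measure Y) [IsProbabilityMeasure p] [IsProbabilityMeasure q] :
    (k₁.prod k₂).covariance (p.prod q) =
      HilbertOp.opTensor J (k₁.covariance p) (k₂.covariance q) := by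
  refine HilbertOp.clm_ext_tmul hJ fun a c => HilbertOp.vec_ext_tmul hJ fun a' c' => ?_
  rw [HilbertOp.opTensor_apply hJ, HilbertOp.inner_tmul, inner_covariance, inner_covariance,
    inner_covariance, ← integral_prod_mul]
  refine integral_congr_ae (Filter.Eventually.of_forall fun z => ?_)
  simp only [← hJf z.1 z.2, HilbertOp.inner_tmul]
  ring

end

end PDKernel

/-! ### Parallel composition -/

theorem mainTheorem8 {𝒟 Ω R₁ R₂ : Type*} [MeasurableSpace Ω]
    [TopologicalSpace R₁] [SecondCountableTopology R₁] [MeasurableSpace R₁] [BorelSpace R₁]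
    [TopologicalSpace R₂] [SecondCountableTopology R₂] [MeasurableSpace R₂] [BorelSpace R₂]
    (μ : MeasureTheory.Measure Ω) [MeasureTheory.IsProbabilityMeasure μ]
    (adj : 𝒟 → 𝒟 → Prop) (k₁ : PDKernel R₁) (k₂ : PDKernel R₂)
    (α lam ε₁ ε₂ : ℝ) (hα : α ∈ Set.Ioo 0 1 ∪ Set.Ioi 1) (hlam : 0 ≤ lam)
    (hε : lam ≤ 3 ∨ 0 ≤ ε₁ + ε₂)
    (f : 𝒟 → Ω → R₁) (g : 𝒟 → Ω → R₂)
    (hf : ∀ D, Measurable (f D)) (hg : ∀ D, Measurable (g D))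
    (hfg : ∀ D, ProbabilityTheory.IndepFun (f D) (g D) μ)
    (h₁ : RKRDP μ adj k₁ α (lam / 3) ε₁ f)
    (h₂ : RKRDP μ adj k₂ α (lam / 3) ε₂ g) :
    RKRDP μ adj (k₁.prod k₂) α lam (ε₁ + ε₂) (fun D ω => (f D ω, g D ω)) := by
  intro D D' hD
  obtain ⟨J, hJ, hJf⟩ := PDKernel.exists_tensor_isometry k₁ k₂
  have hpf (D : 𝒟) : MeasureTheory.IsProbabilityMeasure (μ.map (f D)) :=
    MeasureTheory.Measure.isProbabilityMeasure_map (hf D).aemeasurable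
  have hpg (D : 𝒟) : MeasureTheory.IsProbabilityMeasure (μ.map (g D)) :=
    MeasureTheory.Measure.isProbabilityMeasure_map (hg D).aemeasurable
  have hlaw (D : 𝒟) : μ.map (fun ω => (f D ω, g D ω)) = (μ.map (f D)).prod (μ.map (g D)) :=
    (ProbabilityTheory.indepFun_iff_map_prod_eq_prod_map_map (hf D).aemeasurable
      (hg D).aemeasurable).1 (hfg D)
  have hcov (D : 𝒟) := PDKernel.covariance_prod k₁ k₂ hJ hJf (μ.map (f D)) (μ.map (g D))
  have htr (D : 𝒟) : opTrace (HilbertOp.opTensor J (k₁.covariance (μ.map (f D)))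
      (k₂.covariance (μ.map (g D)))) = 1 := by
    rw [← hcov D]
    exact (k₁.prod k₂).opTrace_covariance _
  rw [hlaw D, hlaw D', hcov D, hcov D']
  exact HilbertOp.regQuantumRenyi_opTensor_le hJ hα (k₁.isPositive_covariance _)
    (k₂.isPositive_covariance _) (k₁.isPositive_covariance _) (k₂.isPositive_covariance _)
    (k₁.opTrace_covariance _) (k₂.opTrace_covariance _) (k₁.opTrace_covariance _)
    (k₂.opTrace_covariance _) (htr D) (htr D') hlam hε (h₁ D D' hD) (h₂ D D' hD)
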